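/- Let $t>0$. Let $\Delta$ be the set of real sequences $\alpha=(\alpha_1\ge\alpha_2\ge\dots\ge 0)$ with $\sum_i\alpha_i\le 1$, with the topology of coordinatewise convergence, and put $\gamma=1-\sum_i\alpha_i$. Let $\Lambda=\mathbb R[p_1,p_2,\dots]$ be the algebra of symmetric functions, $p_k$ being the power sums. For $f\in\Lambda$ let $\tilde f$ be the function on $\Delta$ obtained from $f$, written as a polynomial in $p_1,p_2,\dots$, by the substitution $p_1\mapsto\sum_i\alpha_i+\gamma=1$ and $p_k\mapsto\sum_i\alpha_i^k$ for $k\ge2$. For a partition $\lambda$ of $n$ with $\ell(\lambda)$ parts, $r_k(\lambda)$ of them equal to $k$, let $m_\lambda\in\Lambda$ be the monomial symmetric function and put $$M^{(t)}(\lambda)=\frac{t^{\ell(\lambda)}\,n!}{(t)_n\,z_\lambda},\qquad (t)_n=t(t+1)\cdots(t+n-1),\qquad z_\lambda=\prod_{k\ge1}k^{r_k(\lambda)}\,r_k(\lambda)! .$$ Let $\dim_0\lambda$ be the number of paths from $\varnothing$ to $\lambda$, counted with the multiplicities of edges, in the Kingman graph: its vertices are the partitions, and if $\lambda$ arises from $\mu$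 by increasing a part $k-1\ge0$ to $k$ (a new part if $k=1$), then $\mu$ and $\lambda$ are joined by $r_k(\lambda)$ edges. Then there is a unique Borel probability measure $PD(t)$ on $\Delta$ (the Poisson–Dirichlet distribution) such that $$\int_\Delta\tilde m_\lambda(\alpha)\,PD(t)(d\alpha)=\frac{M^{(t)}(\lambda)}{\dim_0\lambda}\qquad\text{for all partitions }\lambda .$$ Consider the Poisson–Dirichlet process, that is, the random configuration in $(0,1]$ which consists of the nonzero $\alpha_i$ (with multiplicities), where $\alpha$ is distributed according to $PD(t)$. It is simple: almost surely, no point is multiple. For each $n\ge1$ its $n$th correlation measure $$\rho_n=\mathbb E\sum\delta_{(\alpha_{i_1},\dots,\alpha_{i_n})},$$ with the sum over all $n$-tuples of pairwise distinct indices such that $\alpha_{i_1},\dots,\alpha_{i_n}$ are nonzero, is absolutely continuous with respect to Lebesgue measure on $(0,1]^n$, and its density, the $n$th correlation function, is $$\rho_n(x_1,\dots,x_n)=\frac{t^n\,(1-x_1-\dots-x_n)_+^{t-1}}{x_1\cdots x_n},$$ where $y_+^{s}=y^{s}$ for $y>0$ and $y_+^{s}=0$ for $y\le0$. -/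

import Mathlib

open MeasureTheory

noncomputable section

namespace PoissonDirichlet

/-! ### The Kingman graph and the Ewens system -/

/-- The multiplicity of the edge `μ ↗ l` of the Kingman graph. If `μ` is obtained from `l` by
decreasing one part `k` of `l` by `1` (and discarding the result if it is `0`), then the
multiplicity of the edge is the number of parts of `l` equal to `k`; if there is no such `k`, it is
`0`. Different `k` give different `μ`, so at most one summand is nonzero. -/
def edgeMult {n : ℕ} (μ : n.Partition) (l : (n + 1).Partition) : ℕ :=
  ∑ k ∈ l.parts.toFinset,
    if μ.parts = ((k - 1) ::ₘ l.parts.erase k).filter (0 < ·) then l.parts.count k else 0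

/-- The dimension function of the Kingman graph: the number of oriented paths from the empty
partition to `l`, counted with the multiplicities of the edges. -/
def kingmanDim : (n : ℕ) → n.Partition → ℕ
  | 0, _ => 1
  | n + 1, l => ∑ μ : n.Partition, kingmanDim n μ * edgeMult μ l

/-- `z_l = ∏ᵢ lᵢ * ∏ₖ rₖ(l)!`, where `rₖ(l)` is the number of parts of `l` equal to `k`. -/
def zPart {n : ℕ} (l : n.Partition) : ℕ :=
  l.parts.prod * ∏ k ∈ l.parts.toFinset, (l.parts.count k).factorial

/-- The Ewens partition structure `t ^ ℓ(l) * n! / ((t)ₙ * z_l)`, where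
`(t)ₙ = t (t + 1) ⋯ (t + n - 1)`. -/
def ewens (t : ℝ) {n : ℕ} (l : n.Partition) : ℝ :=
  t ^ l.parts.card * (n.factorial : ℝ) / ((ascPochhammer ℝ n).eval t * (zPart l : ℝ))

/-! ### Symmetric functions and their extended versions on the Kingman simplex -/

/-- The algebra of symmetric functions over `ℝ`, as the polynomial algebra `ℝ[p₁, p₂, …]` in the
power sums: the variable with index `k` is the power sum `p_{k+1}`. -/
abbrev SymmFun : Type := MvPolynomial ℕ ℝ

/-- The usual realization of a symmetric function, in the indeterminates `x₁, …, x_N`. -/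
def realize (N : ℕ) : SymmFun →ₐ[ℝ] MvPolynomial (Fin N) ℝ :=
  MvPolynomial.aeval fun k => MvPolynomial.psum (Fin N) ℝ (k + 1)

/-- `F` is the monomial symmetric function `m_l`: in any number of indeterminates it is the sum of
all distinct monomials obtained from `x₁ ^ l₁ * x₂ ^ l₂ * ⋯` by permuting the indeterminates. -/
def IsMonomialSymm {n : ℕ} (l : n.Partition) (F : SymmFun) : Prop :=
  ∀ N : ℕ, realize N F = MvPolynomial.msymm (Fin N) ℝ l

/-- The simplex of sequences `α₁ ≥ α₂ ≥ ⋯ ≥ 0` with `∑ αᵢ ≤ 1` (indexed from `0`), with the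
topology and the Borel structure of coordinatewise convergence. -/
def simplex : Set (ℕ → ℝ) :=
  {α | Antitone α ∧ (∀ i, 0 ≤ α i) ∧ Summable α ∧ ∑' i, α i ≤ 1}

/-- `γ = 1 - ∑ αᵢ`. -/
def gap (α : simplex) : ℝ := 1 - ∑' i, α.1 i

/-- The extended power sum of degree `k ≥ 1`: `∑ αᵢ + γ` for `k = 1` and `∑ αᵢ ^ k` for `k ≥ 2`. -/
def extPowerSum (α : simplex) (k : ℕ) : ℝ :=
  if k = 1 then (∑' i, α.1 i) + gap α else ∑' i, α.1 i ^ k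

/-- The extended version of a symmetric function, a function on the simplex: each generator `p_k`
is replaced by the extended power sum of degree `k`. -/
def extended (F : SymmFun) (α : simplex) : ℝ :=
  MvPolynomial.aeval (fun k => extPowerSum α (k + 1)) F

/-- `P` is the Poisson–Dirichlet distribution with parameter `t`: the probability measure on the
simplex which corresponds to the Ewens system, that is, for each partition `l` the integral of the
extended version of `m_l` is the Ewens weight of `l` divided by the dimension of `l`. -/
def IsPD (t : ℝ) (P : Measure simplex) : Prop :=
  IsProbabilityMeasure P ∧
    ∀ (n : ℕ) (l : n.Partition), ∃ F : SymmFun, IsMonomialSymm l F ∧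
      ∫ α, extended F α ∂P = ewens t l / (kingmanDim n l : ℝ)

/-! ### The point process attached to a measure on the simplex -/

/-- For the configuration `ξ` of the nonzero `αᵢ` (with multiplicities), the sum of the Dirac
masses at `(α_{i₁}, …, α_{iₙ})` over all `n`-tuples of pairwise distinct indices. -/
def tupleMeasure (n : ℕ) (α : simplex) : Measure (Fin n → ℝ) :=
  Measure.sum fun f : {f : Fin n ↪ ℕ // ∀ j, 0 < α.1 (f j)} =>
    Measure.dirac fun j => α.1 (f.1 j)

/-- Measurability of the random measure `tupleMeasure n`, which makes its expectation meaningful. -/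
theorem measurable_tupleMeasure (n : ℕ) : Measurable (tupleMeasure n) := by
  classical
  refine Measure.measurable_of_measurable_coe _ fun s hs => ?_
  have hm : ∀ f : Fin n ↪ ℕ, Measurable fun α : simplex => fun j => α.1 (f j) := fun f =>
    measurable_pi_lambda _ fun j => (measurable_pi_apply _).comp measurable_subtype_coe
  have key : (fun α : simplex => tupleMeasure n α s) = fun α : simplex =>
      ∑' f : Fin n ↪ ℕ, ({α : simplex | ∀ j, 0 < α.1 (f j)} ∩
        (fun α : simplex => fun j => α.1 (f j)) ⁻¹' s).indicator (fun _ => (1 : ENNReal)) α := by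
    funext α
    rw [tupleMeasure, Measure.sum_apply _ hs]
    simp only [Measure.dirac_apply' _ hs]
    refine (tsum_subtype {f : Fin n ↪ ℕ | ∀ j, 0 < α.1 (f j)}
      fun f => s.indicator (1 : (Fin n → ℝ) → ENNReal) fun j => α.1 (f j)).trans ?_
    refine tsum_congr fun f => ?_
    by_cases h1 : ∀ j, 0 < α.1 (f j) <;>
      by_cases h2 : (fun j => α.1 (f j)) ∈ s <;> simp [Set.indicator, h1, h2]
  rw [key]
  have : Countable (Fin n ↪ ℕ) := DFunLike.coe_injective.countable
  refine Measurable.tsum fun f => measurable_const.indicator (.inter ?_ (hm f hs))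
  have h := hm f (MeasurableSet.univ_pi fun _ : Fin n => measurableSet_Ioi (a := (0 : ℝ)))
  simpa [Set.preimage, Set.mem_pi] using h

/-- The `n`th correlation measure of the point process attached to `P`: the expectation of
`tupleMeasure n`. -/
def correlationMeasure (P : Measure simplex) (n : ℕ) : Measure (Fin n → ℝ) :=
  P.bind (tupleMeasure n)

/-- The point process attached to `P` is simple: the random configuration of the nonzero `αᵢ` has
almost surely no multiple points. -/
def IsSimpleProcess (P : Measure simplex) : Prop :=
  ∀ᵐ α ∂P, ∀ i j, i ≠ j → 0 < α.1 i → α.1 i ≠ α.1 j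

/-- `ρ` is the `n`th correlation function of the point process attached to `P`: the process is
simple and its `n`th correlation measure lives on `(0, 1]ⁿ`, with density `ρ` with respect to
Lebesgue measure there. -/
def IsCorrelationFunction (P : Measure simplex) (n : ℕ) (ρ : (Fin n → ℝ) → ℝ) : Prop :=
  IsSimpleProcess P ∧ Measurable ρ ∧ (∀ x, (∀ i, x i ∈ Set.Ioc 0 1) → 0 ≤ ρ x) ∧
    correlationMeasure P n =
      (volume.restrict (Set.univ.pi fun _ : Fin n => Set.Ioc (0 : ℝ) 1)).withDensity
        fun x => ENNReal.ofReal (ρ x)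

/-- `y₊ ^ s`, which is `y ^ s` for `y > 0` and `0` for `y ≤ 0` (also when `s ≤ 0`). -/
def posPow (y s : ℝ) : ℝ := if 0 < y then y ^ s else 0

end PoissonDirichlet

end

noncomputable section

namespace PoissonDirichlet

open Filter Topology

/-! Everything is computed with augmented monomials, the sums of `∏ j, x_{i_j} ^ (b j + 1)` over
tuples of distinct indices. Each is a nonzero multiple of some `m_λ`, and `dim₀ λ = n! / ∏ λᵢ!`, so
`IsPD` prescribes exactly their integrals, `t ^ k * ∏ (b j)! / (t)_n` with `n = ∑ (b j + 1)`
(`isPD_iff`).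

Uniqueness: the extended symmetric functions form a point-separating algebra of continuous functions
on a compact space, and augmented monomials span it linearly (`measure_simplex_ext`). Existence: the
ranked symmetric Dirichlet laws with `N + 1` parameters `t / (N + 1)` have integrals converging to
the prescribed ones (`tendsto_integral_rankedDirichlet`), and compactness supplies a limit law.

Correlation functions: if all exponents are at least `2`, the gap `γ` plays no role, and the
extended augmented monomial at `α` is the integral of the monomial against `tupleMeasure n α`. Hence
these moments of the correlation measure are known (`lintegral_correlationMeasure`); by the
Dirichlet integral the claimed density has the same ones (`lintegral_pdDensity`). After weighting by
`∏ xᵢ ^ 2` both measures are finite on the cube and are determined by their moments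
(`correlationMeasure_eq`). Simplicity follows from `n = 2`: an absolutely continuous measure does
not charge the diagonal. -/

/-! ### Augmented monomial symmetric functions -/

/-- Pairs of an index and a `k`-tuple of distinct indices: either the index is new and can be
put in front of the tuple, or it is an entry of the tuple. -/
def prodEmbeddingMap (T : Type*) (k : ℕ) :
    (Fin (k + 1) ↪ T) ⊕ (Fin k × (Fin k ↪ T)) → T × (Fin k ↪ T)
  | .inl e => (e 0, Fin.Embedding.tail e)
  | .inr p => (p.2 p.1, p.2)

theorem prodEmbeddingMap_bijective (T : Type*) (k : ℕ) :
    Function.Bijective (prodEmbeddingMap T k) := by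
  constructor
  · rintro (e | ⟨j, f⟩) (e' | ⟨j', f'⟩) h
    · simp only [prodEmbeddingMap, Prod.mk.injEq] at h
      congr 1
      ext i
      refine Fin.cases h.1 (fun i => ?_) i
      exact congrArg (fun g : Fin k ↪ T => g i) h.2
    · simp only [prodEmbeddingMap, Prod.mk.injEq] at h
      obtain ⟨h1, rfl⟩ := h
      exact absurd (e.injective h1) (Fin.succ_ne_zero j').symm
    · simp only [prodEmbeddingMap, Prod.mk.injEq] at h
      obtain ⟨h1, rfl⟩ := h
      exact absurd (e'.injective h1.symm) (Fin.succ_ne_zero j).symm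
    · simp only [prodEmbeddingMap, Prod.mk.injEq] at h
      obtain ⟨h1, rfl⟩ := h
      rw [f.injective h1]
  · rintro ⟨i, f⟩
    by_cases h : i ∈ Set.range f
    · obtain ⟨j, rfl⟩ := h
      exact ⟨.inr (j, f), rfl⟩
    · refine ⟨.inl (Fin.Embedding.cons f h), ?_⟩
      simp only [prodEmbeddingMap, Prod.mk.injEq]
      constructor
      · rfl
      · ext j; rfl

/-- The equivalence given by `prodEmbeddingMap`. -/
def prodEmbeddingEquiv (T : Type*) (k : ℕ) :
    (Fin (k + 1) ↪ T) ⊕ (Fin k × (Fin k ↪ T)) ≃ T × (Fin k ↪ T) :=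
  Equiv.ofBijective _ (prodEmbeddingMap_bijective T k)

/-- The monomial with exponents `b j + 1` in the entries of `x` with indices `f j`. -/
def tupleMonomial {R T : Type*} [CommSemiring R] {k : ℕ} (b : Fin k → ℕ) (x : T → R)
    (f : Fin k ↪ T) : R := ∏ j, x (f j) ^ (b j + 1)

/-- The exponents obtained by merging the first exponent into the exponent with index `j`. -/
def mergeExponent {k : ℕ} (b : Fin (k + 1) → ℕ) (j : Fin k) : Fin k → ℕ :=
  Function.update (Fin.tail b) j (Fin.tail b j + b 0 + 1)

theorem mul_tupleMonomial_tail {R T : Type*} [CommSemiring R] {k : ℕ} (b : Fin (k + 1) → ℕ)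
    (x : T → R) (e : Fin (k + 1) ↪ T) :
    x (e 0) ^ (b 0 + 1) * tupleMonomial (Fin.tail b) x (Fin.Embedding.tail e) =
      tupleMonomial b x e := by
  rw [tupleMonomial, tupleMonomial, Fin.prod_univ_succ]
  rfl

theorem mul_tupleMonomial_apply {R T : Type*} [CommSemiring R] {k : ℕ} (b : Fin (k + 1) → ℕ)
    (x : T → R) (j : Fin k) (f : Fin k ↪ T) :
    x (f j) ^ (b 0 + 1) * tupleMonomial (Fin.tail b) x f =
      tupleMonomial (mergeExponent b j) x f := by
  rw [tupleMonomial, tupleMonomial, ← Finset.mul_prod_erase _ _ (Finset.mem_univ j),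
    ← Finset.mul_prod_erase (a := j) _ _ (Finset.mem_univ j), ← mul_assoc, ← pow_add]
  congr 1
  · rw [mergeExponent, Function.update_self]
    congr 1
    ring
  · refine Finset.prod_congr rfl fun i hi => ?_
    rw [mergeExponent, Function.update_of_ne (Finset.ne_of_mem_erase hi)]

/-- The augmented monomial symmetric function with exponents `b j + 1`, as a polynomial in the
power sums: the sum over all tuples of distinct indices of `∏ j, x_{i_j} ^ (b j + 1)`. -/
def augMonomial : (k : ℕ) → (Fin k → ℕ) → SymmFun
  | 0, _ => 1
  -- `X (b 0)` is the power sum of degree `b 0 + 1`. Its product with the shorter sum also contains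
  -- the terms whose new index repeats index `j`; these are subtracted.
  | k + 1, b => MvPolynomial.X (b 0) * augMonomial k (Fin.tail b) -
      ∑ j, augMonomial k (mergeExponent b j)

/-- The index of the power sum is either new or one of the entries of the tuple; in the second case
the exponents merge. -/
theorem sum_mul_sum_tupleMonomial {R T : Type*} [CommSemiring R] [Fintype T] [DecidableEq T]
    {k : ℕ} (b : Fin (k + 1) → ℕ) (x : T → R) :
    (∑ i, x i ^ (b 0 + 1)) * ∑ f : Fin k ↪ T, tupleMonomial (Fin.tail b) x f =
      (∑ f : Fin (k + 1) ↪ T, tupleMonomial b x f) +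
        ∑ j, ∑ f : Fin k ↪ T, tupleMonomial (mergeExponent b j) x f := by
  rw [Fintype.sum_mul_sum, ← Fintype.sum_prod_type',
    ← Equiv.sum_comp (prodEmbeddingEquiv T k), Fintype.sum_sum_type, Fintype.sum_prod_type]
  congr 1
  · exact Finset.sum_congr rfl fun e _ => mul_tupleMonomial_tail b x e
  · exact Finset.sum_congr rfl fun j _ => Finset.sum_congr rfl fun f _ =>
      mul_tupleMonomial_apply b x j f

/-- The same splitting for infinitely many variables; values in `ENNReal` make every rearrangement
free. -/
theorem tsum_mul_tsum_tupleMonomial {T : Type*} {k : ℕ} (b : Fin (k + 1) → ℕ)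
    (x : T → ENNReal) :
    (∑' i, x i ^ (b 0 + 1)) * ∑' f : Fin k ↪ T, tupleMonomial (Fin.tail b) x f =
      (∑' f : Fin (k + 1) ↪ T, tupleMonomial b x f) +
        ∑ j, ∑' f : Fin k ↪ T, tupleMonomial (mergeExponent b j) x f := by
  have h : (∑' i, x i ^ (b 0 + 1)) * ∑' f : Fin k ↪ T, tupleMonomial (Fin.tail b) x f =
      ∑' p : T × (Fin k ↪ T), x p.1 ^ (b 0 + 1) * tupleMonomial (Fin.tail b) x p.2 := by
    rw [ENNReal.tsum_prod (f := fun i f => x i ^ (b 0 + 1) * tupleMonomial (Fin.tail b) x f),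
      ← ENNReal.tsum_mul_right]
    exact tsum_congr fun i => ENNReal.tsum_mul_left.symm
  rw [h, ← Equiv.tsum_eq (prodEmbeddingEquiv T k),
    Summable.tsum_sum ENNReal.summable ENNReal.summable]
  congr 1
  · exact tsum_congr fun e => mul_tupleMonomial_tail b x e
  · rw [← tsum_fintype (L := .unconditional _), ← ENNReal.tsum_prod]
    exact tsum_congr fun p => mul_tupleMonomial_apply b x p.1 p.2

theorem realize_augMonomial (N k : ℕ) (b : Fin k → ℕ) :
    realize N (augMonomial k b) =
      ∑ f : Fin k ↪ Fin N, tupleMonomial b (MvPolynomial.X : _ → MvPolynomial (Fin N) ℝ) f := by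
  induction k with
  | zero => simp [augMonomial, tupleMonomial]
  | succ k ih =>
    rw [augMonomial, map_sub, map_mul, map_sum, sub_eq_iff_eq_add]
    simp only [ih]
    rw [← sum_mul_sum_tupleMonomial]
    simp [realize, MvPolynomial.psum]

/-- By monotonicity `(i + 1) αᵢ` is at most the sum of the first `i + 1` terms. The bound is uniform
in `α`, which later gives continuity of the power sums. -/
theorem simplex_le_one_div (α : simplex) (i : ℕ) : α.1 i ≤ 1 / (i + 1) := by
  obtain ⟨hanti, hnn, hs, h1⟩ := α.2
  rw [le_div_iff₀ (by positivity)]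
  calc α.1 i * (i + 1) = ∑ _j ∈ Finset.range (i + 1), α.1 i := by simp [mul_comm]
    _ ≤ ∑ j ∈ Finset.range (i + 1), α.1 j :=
        Finset.sum_le_sum fun j hj => hanti (by simpa [Nat.lt_succ_iff] using hj)
    _ ≤ ∑' j, α.1 j := hs.sum_le_tsum _ fun j _ => hnn j
    _ ≤ 1 := h1

theorem simplex_le_one (α : simplex) (i : ℕ) : α.1 i ≤ 1 := by
  refine (simplex_le_one_div α i).trans ?_
  rw [div_le_one (by positivity)]
  simp

theorem summable_simplex_pow (α : simplex) {m : ℕ} (hm : m ≠ 0) :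
    Summable fun i => α.1 i ^ m := by
  obtain ⟨hanti, hnn, hs, h1⟩ := α.2
  exact hs.of_nonneg_of_le (fun i => pow_nonneg (hnn i) _) fun i =>
    pow_le_of_le_one (hnn i) (simplex_le_one α i) hm

theorem extPowerSum_one (α : simplex) : extPowerSum α 1 = 1 := by
  simp [extPowerSum, gap]

theorem extPowerSum_of_ne_one (α : simplex) {m : ℕ} (hm : m ≠ 1) :
    extPowerSum α m = ∑' i, α.1 i ^ m := by
  simp [extPowerSum, hm]

/-- The sum over tuples of distinct indices which defines the augmented monomial symmetric
function with exponents at least `2` converges to its extended version. -/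
theorem tsum_tupleMonomial_simplex (α : simplex) (k : ℕ) (b : Fin k → ℕ) (hb : ∀ j, b j ≠ 0) :
    (∑' f : Fin k ↪ ℕ, tupleMonomial b (fun i => ENNReal.ofReal (α.1 i)) f =
      ENNReal.ofReal (extended (augMonomial k b) α)) ∧ 0 ≤ extended (augMonomial k b) α := by
  induction k with
  | zero => simp [augMonomial, tupleMonomial, extended, tsum_fintype]
  | succ k ih =>
    have hnn := α.2.2.1
    have h := tsum_mul_tsum_tupleMonomial b (fun i => ENNReal.ofReal (α.1 i))
    have ht := ih (Fin.tail b) fun j => hb j.succ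
    have hm : ∀ j, _ := fun j => ih (mergeExponent b j) fun i => by
      by_cases hij : i = j
      · subst hij; simp [mergeExponent]
      · rw [mergeExponent, Function.update_of_ne hij]
        exact hb i.succ
    -- As `b 0 ≠ 0`, the degree is at least `2`, so the extended power sum is the plain one; tails
    -- and merged exponents keep this property.
    have hp : ∑' i, ENNReal.ofReal (α.1 i) ^ (b 0 + 1) =
        ENNReal.ofReal (extPowerSum α (b 0 + 1)) := by
      rw [extPowerSum_of_ne_one α (by simpa using hb 0), ENNReal.ofReal_tsum_of_nonneg
        (fun i => pow_nonneg (hnn i) _) (summable_simplex_pow α (Nat.succ_ne_zero _))]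
      exact tsum_congr fun i => (ENNReal.ofReal_pow (hnn i) _).symm
    have hp0 : 0 ≤ extPowerSum α (b 0 + 1) := by
      rw [extPowerSum_of_ne_one α (by simpa using hb 0)]
      exact tsum_nonneg fun i => pow_nonneg (hnn i) _
    have hE : extended (augMonomial (k + 1) b) α =
        extPowerSum α (b 0 + 1) * extended (augMonomial k (Fin.tail b)) α -
          ∑ j, extended (augMonomial k (mergeExponent b j)) α := by
      simp [extended, augMonomial]
    have hs0 : 0 ≤ ∑ j, extended (augMonomial k (mergeExponent b j)) α :=
      Finset.sum_nonneg fun j _ => (hm j).2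
    rw [hp, ht.1, ← ENNReal.ofReal_mul hp0, Finset.sum_congr rfl fun j _ => (hm j).1,
      ← ENNReal.ofReal_sum_of_nonneg fun j _ => (hm j).2] at h
    constructor
    · rw [hE, ENNReal.ofReal_sub _ hs0, h, ENNReal.add_sub_cancel_right ENNReal.ofReal_ne_top]
    -- Nonnegativity is read off from the recursion: the product equals the subtracted sum plus an
    -- element of `ENNReal`.
    · rw [hE, sub_nonneg, ← ENNReal.ofReal_le_ofReal_iff (mul_nonneg hp0 ht.2), h]
      exact le_add_self

/-- The augmented monomial symmetric functions span the algebra of symmetric functions. -/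
theorem span_augMonomial :
    Submodule.span ℝ {F : SymmFun | ∃ k b, F = augMonomial k b} = ⊤ := by
  set V := Submodule.span ℝ {F : SymmFun | ∃ k b, F = augMonomial k b} with hV
  have hmem : ∀ k b, augMonomial k b ∈ V := fun k b => Submodule.subset_span ⟨k, b, rfl⟩
  -- Read backwards, the defining recursion shows that the span is stable under multiplication by
  -- each power sum.
  have hX : ∀ (m : ℕ) (F : SymmFun), F ∈ V → F * MvPolynomial.X m ∈ V := by
    intro m F hF
    induction hF using Submodule.span_induction with
    | mem F hF =>
      obtain ⟨k, b, rfl⟩ := hF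
      have h : augMonomial k b * MvPolynomial.X m = augMonomial (k + 1) (Fin.cons m b) +
          ∑ j, augMonomial k (mergeExponent (Fin.cons m b) j) := by
        simp [augMonomial, mul_comm]
      rw [h]
      exact V.add_mem (hmem _ _) (V.sum_mem fun j _ => hmem _ _)
    | zero => simp
    | add F G _ _ hF hG => rw [add_mul]; exact V.add_mem hF hG
    | smul c F _ hF => rw [smul_mul_assoc]; exact V.smul_mem c hF
  rw [eq_top_iff]
  rintro F -
  induction F using MvPolynomial.induction_on with
  | C c =>
    have : (MvPolynomial.C c : SymmFun) = c • augMonomial 0 Fin.elim0 := by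
      rw [augMonomial, MvPolynomial.smul_eq_C_mul, mul_one]
    rw [this]
    exact V.smul_mem c (hmem _ _)
  | add F G hF hG => exact V.add_mem hF hG
  | mul_X F m hF => exact hX m F hF

/-! ### Extended versions as limits of finite realizations. -/

theorem eval_realize (N : ℕ) (F : SymmFun) (x : Fin N → ℝ) :
    MvPolynomial.eval x (realize N F) =
      MvPolynomial.eval (fun k => ∑ i, x i ^ (k + 1)) F := by
  rw [realize, ← MvPolynomial.coe_aeval_eq_eval, ← MvPolynomial.coe_aeval_eq_eval]
  change ((MvPolynomial.aeval x).comp (MvPolynomial.aeval _)) F = MvPolynomial.aeval _ F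
  rw [MvPolynomial.comp_aeval]
  simp [MvPolynomial.psum]

/-- The extended version of a symmetric function is determined by its realizations. -/
theorem extended_eq_zero_of_realize_eq_zero {F : SymmFun} (hF : ∀ N, realize N F = 0)
    (α : simplex) : extended F α = 0 := by
  obtain ⟨hanti, hnn, hs, h1⟩ := α.2
  -- The missing mass of the first `N` coordinates is spread equally over `N` extra variables. For
  -- `N > 0` this makes `p₁` exactly `1`, while in degree at least `2` the extra variables
  -- contribute at most `1 / N`.
  let c : ℕ → ℝ := fun N => 1 - ∑ i ∈ Finset.range N, α.1 i
  let p : ℕ → ℕ → ℝ := fun N k =>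
    ∑ i ∈ Finset.range N, α.1 i ^ (k + 1) + N * (c N / N) ^ (k + 1)
  have hp : ∀ N, MvPolynomial.eval (p N) F = 0 := by
    intro N
    have h := eval_realize (N + N) F (Fin.append (fun i => α.1 i) fun _ => c N / N)
    rw [hF, map_zero] at h
    rw [h]
    congr 2
    ext k
    rw [Fin.sum_univ_add]
    simp only [Fin.append_left, Fin.append_right]
    simp [p, Finset.sum_range]
  have hc0 : ∀ N, 0 ≤ c N := fun N =>
    sub_nonneg.2 ((hs.sum_le_tsum _ fun j _ => hnn j).trans h1)
  have hc1 : ∀ N, c N ≤ 1 := fun N =>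
    sub_le_self _ (Finset.sum_nonneg fun i _ => hnn i)
  have hlim : Tendsto p atTop (𝓝 fun k => extPowerSum α (k + 1)) := by
    rw [tendsto_pi_nhds]
    intro k
    rcases Nat.eq_zero_or_pos k with rfl | hk
    · rw [zero_add, extPowerSum_one]
      refine tendsto_const_nhds.congr' ?_
      filter_upwards [eventually_gt_atTop 0] with N hN
      have : (N : ℝ) ≠ 0 := by positivity
      simp only [p, c, zero_add, pow_one]
      field_simp
      ring
    · rw [extPowerSum_of_ne_one α (by omega)]
      have h2 : Tendsto (fun N : ℕ => (N : ℝ) * (c N / N) ^ (k + 1)) atTop (𝓝 0) := by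
        refine squeeze_zero' (.of_forall fun N => by have := hc0 N; positivity) ?_
          tendsto_one_div_atTop_nhds_zero_nat
        filter_upwards [eventually_gt_atTop 0] with N hN
        have hN' : (0 : ℝ) < N := by positivity
        have hle : (c N / N) ^ (k + 1) ≤ (c N / N) ^ 2 :=
          pow_le_pow_of_le_one (div_nonneg (hc0 N) hN'.le)
            ((div_le_one hN').2 ((hc1 N).trans (by exact_mod_cast hN))) (by omega)
        calc (N : ℝ) * (c N / N) ^ (k + 1) ≤ N * (c N / N) ^ 2 := by gcongr
          _ = c N ^ 2 / N := by field_simp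
          _ ≤ 1 / N := by
            have := pow_le_one₀ (n := 2) (hc0 N) (hc1 N)
            gcongr
      simpa [p] using (summable_simplex_pow α (Nat.succ_ne_zero k)).hasSum.tendsto_sum_nat.add h2
  have := ((MvPolynomial.continuous_eval F).tendsto _).comp hlim
  have h0 : (fun N => MvPolynomial.eval (p N) F) = fun _ => 0 := funext hp
  rw [Function.comp_def, h0] at this
  rw [extended, MvPolynomial.aeval_eq_eval]
  exact tendsto_nhds_unique this tendsto_const_nhds

/-! ### Monomial symmetric functions and the Kingman graph -/

/-- The multiset in which the entry with index `j` of the tuple `f` has multiplicity `b j + 1`. -/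
def tupleMultiset {σ : Type*} {k : ℕ} (b : Fin k → ℕ) (f : Fin k ↪ σ) : Multiset σ :=
  ∑ j, (b j + 1) • {f j}

theorem card_tupleMultiset {σ : Type*} {k : ℕ} (b : Fin k → ℕ) (f : Fin k ↪ σ) :
    (tupleMultiset b f).card = ∑ j, (b j + 1) := by
  simp [tupleMultiset]

theorem count_tupleMultiset {σ : Type*} [DecidableEq σ] {k : ℕ} (b : Fin k → ℕ)
    (f : Fin k ↪ σ) (j : Fin k) : (tupleMultiset b f).count (f j) = b j + 1 := by
  simp [tupleMultiset, Multiset.count_sum', Multiset.count_singleton, Finset.sum_ite_eq]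

theorem mem_tupleMultiset {σ : Type*} {k : ℕ} (b : Fin k → ℕ)
    (f : Fin k ↪ σ) (x : σ) : x ∈ tupleMultiset b f ↔ x ∈ Set.range f := by
  simp [tupleMultiset, Multiset.mem_sum, Multiset.mem_nsmul, eq_comm]

theorem prod_map_tupleMultiset {σ R : Type*} [CommSemiring R] {k : ℕ} (b : Fin k → ℕ)
    (f : Fin k ↪ σ) (x : σ → R) :
    ((tupleMultiset b f).map x).prod = tupleMonomial b x f := by
  rw [tupleMultiset, tupleMonomial, ← Multiset.coe_mapAddMonoidHom, map_sum, Multiset.prod_sum]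
  simp [Multiset.map_nsmul, Multiset.prod_nsmul]

theorem dedup_tupleMultiset {σ : Type*} [DecidableEq σ] {k : ℕ} (b : Fin k → ℕ)
    (f : Fin k ↪ σ) : (tupleMultiset b f).dedup = Finset.univ.val.map f := by
  refine (Multiset.Nodup.ext (Multiset.nodup_dedup _)
    (Finset.univ.nodup.map f.injective)).2 fun x => ?_
  simp [mem_tupleMultiset]

/-- The counts give only one inclusion; equal cardinality excludes further elements of `s`. -/
theorem eq_tupleMultiset_iff {σ : Type*} [DecidableEq σ] {k : ℕ} (b : Fin k → ℕ)
    (f : Fin k ↪ σ) (s : Multiset σ) (hs : s.card = ∑ j, (b j + 1)) :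
    tupleMultiset b f = s ↔ ∀ j, s.count (f j) = b j + 1 := by
  constructor
  · rintro rfl j
    exact count_tupleMultiset b f j
  · intro h
    refine Multiset.eq_of_le_of_card_le ?_ (by rw [card_tupleMultiset, hs])
    rw [Multiset.le_iff_count]
    intro x
    by_cases hx : x ∈ Set.range f
    · obtain ⟨j, rfl⟩ := hx
      rw [h, count_tupleMultiset]
    · rw [← mem_tupleMultiset b f, ← Multiset.count_eq_zero] at hx
      simp [hx]

theorem card_filter_map_eq {ι : Type*} [Fintype ι] (a : ι → ℕ) (c : ℕ)
    [Fintype {i // a i = c}] :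
    Fintype.card {i // a i = c} = (Finset.univ.val.map a).count c := by
  rw [Multiset.count_map, Fintype.card_subtype]
  simp [Finset.card, eq_comm]

/-- The number of tuples of distinct indices which give rise to a multiset with prescribed
multiplicities. -/
theorem card_tupleMultiset_eq {σ : Type*} [Fintype σ] [DecidableEq σ] {k : ℕ} (b : Fin k → ℕ)
    (s : Multiset σ) (hs : s.dedup.map s.count = Finset.univ.val.map fun j => b j + 1) :
    Fintype.card {f : Fin k ↪ σ // tupleMultiset b f = s} =
      ∏ m ∈ (s.dedup.map s.count).toFinset, ((s.dedup.map s.count).count m).factorial := by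
  have hcard : s.card = ∑ j, (b j + 1) := by
    have h := congrArg Multiset.sum hs
    have h1 : (s.dedup.map s.count).sum = s.card := Multiset.toFinset_sum_count_eq s
    rw [h1] at h
    exact h
  -- One tuple is built by matching, for each `c`, the slots with exponent `c` with the elements of
  -- multiplicity `c`.
  obtain ⟨f, hf⟩ : ∃ f : Fin k ↪ σ, tupleMultiset b f = s := by
    have hval : Finset.univ.val.map (fun x : s.toFinset => s.count x.1) =
        s.dedup.map s.count := by
      change _ = s.toFinset.val.map s.count
      conv_rhs => rw [← Finset.attach_map_val (s := s.toFinset), Finset.map_val, Multiset.map_map]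
      rfl
    have hfib : ∀ c, Nonempty ({j : Fin k // b j + 1 = c} ≃ {x : s.toFinset // s.count x.1 = c}) :=
      fun c => ⟨Fintype.equivOfCardEq (by
        rw [card_filter_map_eq, card_filter_map_eq, hval, hs])⟩
    let e : Fin k ≃ s.toFinset := Equiv.ofFiberEquiv (f := fun j => b j + 1)
      (g := fun x : s.toFinset => s.count x.1) fun c => (hfib c).some
    refine ⟨e.toEmbedding.trans (Function.Embedding.subtype _), ?_⟩
    rw [eq_tupleMultiset_iff _ _ _ hcard]
    exact fun j => Equiv.ofFiberEquiv_map (f := fun j => b j + 1)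
      (g := fun x : s.toFinset => s.count x.1) (fun c => (hfib c).some) j
  have hcount := (eq_tupleMultiset_iff b f s hcard).1 hf
  have hrange : ∀ g : Fin k ↪ σ, tupleMultiset b g = s → ∀ j, g j ∈ Set.range f := by
    intro g hg j
    rw [← mem_tupleMultiset b f, hf, ← hg, mem_tupleMultiset]
    exact ⟨j, rfl⟩
  -- All other tuples are `f` composed with a permutation preserving the exponents, so the count is
  -- the order of a stabilizer.
  let Φ : {g : Equiv.Perm (Fin k) // (fun j => b j + 1) ∘ g = fun j => b j + 1} →
      {f : Fin k ↪ σ // tupleMultiset b f = s} := fun g =>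
    ⟨g.1.toEmbedding.trans f, by
      rw [eq_tupleMultiset_iff _ _ _ hcard]
      intro j
      rw [← congrFun g.2 j]
      exact hcount (g.1 j)⟩
  have hΦ : Function.Bijective Φ := by
    constructor
    · intro g g' h
      refine Subtype.ext (Equiv.ext fun j => f.injective ?_)
      exact congrArg (fun u : {f : Fin k ↪ σ // tupleMultiset b f = s} => u.1 j) h
    · rintro ⟨g, hg⟩
      choose π hπ using hrange g hg
      have hinj : Function.Injective π := fun i j h => g.injective (by rw [← hπ, ← hπ, h])
      refine ⟨⟨Equiv.ofBijective π (Finite.injective_iff_bijective.1 hinj), ?_⟩, ?_⟩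
      · ext j
        have h1 := hcount (π j)
        rw [hπ, (eq_tupleMultiset_iff b g s hcard).1 hg j] at h1
        exact h1.symm
      · exact Subtype.ext (Function.Embedding.ext hπ)
  rw [← Fintype.card_of_bijective hΦ, DomMulAct.stabilizer_card', hs]
  refine Finset.prod_congr ?_ fun m _ => ?_
  · ext m; simp
  · rw [card_filter_map_eq]

/-- Tuples are grouped by the monomial they produce; each monomial of type `l` has a fibre of the
same size. -/
theorem sum_tupleMonomial_eq_msymm {σ : Type*} [Fintype σ] [DecidableEq σ] {n k : ℕ}
    (l : n.Partition) (b : Fin k → ℕ) (hl : l.parts = Finset.univ.val.map fun j => b j + 1) :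
    ∑ f : Fin k ↪ σ, tupleMonomial b (MvPolynomial.X : σ → MvPolynomial σ ℝ) f =
      ((∏ m ∈ l.parts.toFinset, (l.parts.count m).factorial : ℕ) : ℝ) •
        MvPolynomial.msymm σ ℝ l := by
  have hn : ∑ j, (b j + 1) = n := by
    have h := l.parts_sum
    rw [hl] at h
    exact h
  let S : (Fin k ↪ σ) → {a : Sym σ n // Nat.Partition.ofSym a = l} := fun f =>
    ⟨⟨tupleMultiset b f, by rw [card_tupleMultiset, hn]⟩, by
      apply Nat.Partition.ext
      change (tupleMultiset b f).dedup.map (tupleMultiset b f).count = _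
      rw [dedup_tupleMultiset, Multiset.map_map, hl]
      exact Multiset.map_congr rfl fun j _ => count_tupleMultiset b f j⟩
  rw [MvPolynomial.msymm, Finset.smul_sum, ← Finset.sum_fiberwise (g := S)]
  refine Finset.sum_congr rfl fun s _ => ?_
  have hs : s.1.1.dedup.map s.1.1.count = l.parts := congrArg Nat.Partition.parts s.2
  rw [Finset.sum_congr rfl (g := fun _ => (s.1.1.map MvPolynomial.X).prod), Finset.sum_const,
    Nat.cast_smul_eq_nsmul]
  · congr 1
    rw [← hs, ← card_tupleMultiset_eq b s.1.1 (hs.trans hl), Fintype.card_subtype]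
    congr 1
    ext f
    simp only [Finset.mem_filter, Finset.mem_univ, true_and]
    exact Subtype.ext_iff.trans Subtype.ext_iff
  · intro f hf
    rw [Finset.mem_filter] at hf
    rw [← hf.2, ← prod_map_tupleMultiset]

/-- The partition with parts `b j + 1`. -/
def partitionOfExponents {k : ℕ} (b : Fin k → ℕ) : (∑ j, (b j + 1)).Partition where
  parts := Finset.univ.val.map fun j => b j + 1
  parts_pos := by simp +contextual
  parts_sum := rfl

theorem exists_exponents {n : ℕ} (l : n.Partition) :
    ∃ (k : ℕ) (b : Fin k → ℕ), l.parts = Finset.univ.val.map fun j => b j + 1 := by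
  obtain ⟨L, hL⟩ := Quot.exists_rep l.parts
  refine ⟨L.length, fun j => L.get j - 1, ?_⟩
  have h : ∀ j : Fin L.length, L.get j - 1 + 1 = L.get j := fun j =>
    Nat.sub_add_cancel (l.parts_pos (i := L.get j) (by rw [← hL]; exact List.get_mem L j))
  simp only [h]
  rw [Fin.univ_val_map, List.ofFn_get]
  exact hL.symm

theorem isMonomialSymm_augMonomial {n k : ℕ} (l : n.Partition) (b : Fin k → ℕ)
    (hl : l.parts = Finset.univ.val.map fun j => b j + 1) :
    IsMonomialSymm l
      (((∏ m ∈ l.parts.toFinset, (l.parts.count m).factorial : ℕ) : ℝ)⁻¹ • augMonomial k b) := by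
  intro N
  rw [map_smul, realize_augMonomial, sum_tupleMonomial_eq_msymm l b hl, smul_smul,
    inv_mul_cancel₀, one_smul]
  exact Nat.cast_ne_zero.2 (Finset.prod_ne_zero_iff.2 fun m _ => Nat.factorial_ne_zero _)

/-- Makes the existential quantifier in `IsPD` harmless: the integrand does not depend on the chosen
`F`. -/
theorem extended_eq_of_isMonomialSymm {n : ℕ} {l : n.Partition} {F G : SymmFun}
    (hF : IsMonomialSymm l F) (hG : IsMonomialSymm l G) : extended F = extended G := by
  ext α
  have h := extended_eq_zero_of_realize_eq_zero (F := F - G)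
    (fun N => by rw [map_sub, hF N, hG N, sub_self]) α
  rw [extended, map_sub, sub_eq_zero] at h
  exact h

/-- The partition obtained by decreasing a part by `1`. -/
def decreasePart {n : ℕ} (l : (n + 1).Partition) (m : ℕ) (hm : m ∈ l.parts) : n.Partition where
  parts := ((m - 1) ::ₘ l.parts.erase m).filter (0 < ·)
  parts_pos := fun h => (Multiset.mem_filter.1 h).2
  parts_sum := by
    have h1 : ∀ s : Multiset ℕ, (s.filter (0 < ·)).sum = s.sum := by
      intro s
      induction s using Multiset.induction_on with
      | empty => simp
      | cons a s ih =>
        rcases Nat.eq_zero_or_pos a with rfl | ha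
        · simpa using ih
        · rw [Multiset.filter_cons_of_pos (p := (0 < ·)) _ ha, Multiset.sum_cons, Multiset.sum_cons, ih]
    rw [h1, Multiset.sum_cons]
    have h2 := l.parts_sum
    rw [← Multiset.cons_erase hm, Multiset.sum_cons] at h2
    have h3 := l.parts_pos hm
    omega

theorem prod_factorial_decreasePart {n : ℕ} (l : (n + 1).Partition) (m : ℕ) (hm : m ∈ l.parts) :
    (l.parts.map Nat.factorial).prod =
      m * ((decreasePart l m hm).parts.map Nat.factorial).prod := by
  have h1 : ∀ s : Multiset ℕ, ((s.filter (0 < ·)).map Nat.factorial).prod =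
      (s.map Nat.factorial).prod := by
    intro s
    induction s using Multiset.induction_on with
    | empty => simp
    | cons a s ih =>
      rcases Nat.eq_zero_or_pos a with rfl | ha
      · simpa using ih
      · rw [Multiset.filter_cons_of_pos (p := (0 < ·)) _ ha, Multiset.map_cons, Multiset.prod_cons,
          Multiset.map_cons, Multiset.prod_cons, ih]
  rw [decreasePart, h1, Multiset.map_cons, Multiset.prod_cons, ← mul_assoc,
    Nat.mul_factorial_pred (l.parts_pos hm).ne', ← Multiset.prod_cons, ← Multiset.map_cons,
    Multiset.cons_erase hm]

/-- Lowering a part `m` divides the product of factorials by `m`, so the induction reduces to the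
identity that the sum of `m * count m` over the distinct parts is `n + 1`. -/
theorem kingmanDim_mul_prod_factorial (n : ℕ) (l : n.Partition) :
    kingmanDim n l * (l.parts.map Nat.factorial).prod = n.factorial := by
  induction n with
  | zero => simp [kingmanDim]
  | succ n ih =>
    have h : ∀ m (hm : m ∈ l.parts.toFinset), ∑ μ : n.Partition, kingmanDim n μ *
        (if μ.parts = ((m - 1) ::ₘ l.parts.erase m).filter (0 < ·) then l.parts.count m else 0) =
        kingmanDim n (decreasePart l m (Multiset.mem_toFinset.1 hm)) * l.parts.count m := by
      intro m hm
      rw [Finset.sum_eq_single (decreasePart l m (Multiset.mem_toFinset.1 hm))]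
      · rw [if_pos (by rfl)]
      · intro μ _ hμ
        rw [if_neg (by exact fun h => hμ (Nat.Partition.ext h)), mul_zero]
      · simp
    simp only [kingmanDim, edgeMult, Finset.mul_sum]
    rw [Finset.sum_comm, ← Finset.sum_attach,
      Finset.sum_congr rfl fun m _ => h m.1 m.2, Finset.sum_mul]
    have h2 : ∀ m : {m // m ∈ l.parts.toFinset},
        kingmanDim n (decreasePart l m.1 (Multiset.mem_toFinset.1 m.2)) * l.parts.count m.1 *
          (l.parts.map Nat.factorial).prod = l.parts.count m.1 * m.1 * n.factorial := by
      intro m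
      rw [prod_factorial_decreasePart l m.1 (Multiset.mem_toFinset.1 m.2), ← ih]
      ring
    rw [Finset.sum_congr rfl fun m _ => h2 m, ← Finset.sum_mul,
      Finset.sum_attach _ fun m => l.parts.count m * m, Nat.factorial_succ]
    congr 1
    have := Finset.sum_multiset_count l.parts
    simp only [smul_eq_mul] at this
    rw [← this, l.parts_sum]

/-! ### The moments prescribed by the Ewens system. -/

/-- The integral of the augmented monomial symmetric function with exponents `b j + 1` against the
Poisson–Dirichlet distribution. -/
def ewensMoment (t : ℝ) {k : ℕ} (b : Fin k → ℕ) : ℝ :=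
  t ^ k * (∏ j, ((b j).factorial : ℝ)) / (ascPochhammer ℝ (∑ j, (b j + 1))).eval t

/-- Dividing by the dimension replaces `n!` by `∏ (b j + 1)!`; the factors `b j + 1` in `zPart` turn
this into `∏ (b j)!`. -/
theorem ewens_div_kingmanDim (t : ℝ) {n k : ℕ} (l : n.Partition) (b : Fin k → ℕ)
    (hl : l.parts = Finset.univ.val.map fun j => b j + 1) :
    ewens t l / (kingmanDim n l : ℝ) =
      ((∏ m ∈ l.parts.toFinset, (l.parts.count m).factorial : ℕ) : ℝ)⁻¹ * ewensMoment t b := by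
  have hn : ∑ j, (b j + 1) = n := by
    have h := l.parts_sum
    rw [hl] at h
    exact h
  have hd : (kingmanDim n l : ℝ) * ∏ j, (((b j + 1).factorial : ℕ) : ℝ) = n.factorial := by
    rw [← kingmanDim_mul_prod_factorial n l, hl, Multiset.map_map]
    change _ = ((kingmanDim n l * ∏ j, (b j + 1).factorial : ℕ) : ℝ)
    push_cast
    rfl
  have hk : l.parts.card = k := by simp [hl]
  have hp : (l.parts.prod : ℝ) = ∏ j, ((b j : ℝ) + 1) := by
    rw [hl]
    change ((∏ j, (b j + 1) : ℕ) : ℝ) = _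
    push_cast
    rfl
  have hd0 : (kingmanDim n l : ℝ) ≠ 0 := by
    intro h
    rw [h, zero_mul] at hd
    exact Nat.cast_ne_zero.2 (Nat.factorial_ne_zero n) hd.symm
  have hp0 : ∏ j, ((b j : ℝ) + 1) ≠ 0 := Finset.prod_ne_zero_iff.2 fun j _ => by positivity
  rw [ewens, ewensMoment, zPart, hn, hk, ← hd]
  rw [Nat.cast_mul, hp]
  push_cast [Nat.factorial_succ]
  rw [Finset.prod_mul_distrib]
  field_simp

/-- The Poisson–Dirichlet distribution in terms of augmented monomial symmetric functions. -/
theorem isPD_iff (t : ℝ) (P : Measure simplex) :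
    IsPD t P ↔ IsProbabilityMeasure P ∧ ∀ (k : ℕ) (b : Fin k → ℕ),
      ∫ α, extended (augMonomial k b) α ∂P = ewensMoment t b := by
  refine and_congr_right fun _ => ⟨fun h k b => ?_, fun h n l => ?_⟩
  · obtain ⟨F, hF, hi⟩ := h _ (partitionOfExponents b)
    rw [extended_eq_of_isMonomialSymm hF (isMonomialSymm_augMonomial _ b rfl),
      ewens_div_kingmanDim t _ b rfl] at hi
    simp only [extended, map_smul, smul_eq_mul, integral_const_mul] at hi
    refine mul_left_cancel₀ (inv_ne_zero (Nat.cast_ne_zero.2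
      (Finset.prod_ne_zero_iff.2 fun m _ => Nat.factorial_ne_zero _))) hi
  · obtain ⟨k, b, hl⟩ := exists_exponents l
    refine ⟨_, isMonomialSymm_augMonomial l b hl, ?_⟩
    rw [ewens_div_kingmanDim t _ b hl, ← h]
    simp only [extended, map_smul, smul_eq_mul, integral_const_mul]

/-! ### The topology of the simplex and uniqueness -/

/-- For nonnegative terms, summability with sum at most `1` is a bound on every partial sum, hence
an intersection of closed conditions. -/
theorem isClosed_simplex : IsClosed simplex := by
  have h : simplex = {α : ℕ → ℝ | (∀ i j, i ≤ j → α j ≤ α i) ∧ (∀ i, 0 ≤ α i) ∧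
      ∀ N, ∑ i ∈ Finset.range N, α i ≤ 1} := by
    ext α
    constructor
    · rintro ⟨h1, h2, h3, h4⟩
      exact ⟨fun i j h => h1 h, h2, fun N => (h3.sum_le_tsum _ fun i _ => h2 i).trans h4⟩
    · rintro ⟨h1, h2, h3⟩
      exact ⟨fun i j h => h1 i j h, h2, summable_of_sum_range_le h2 h3,
        Real.tsum_le_of_sum_range_le h2 h3⟩
  rw [h]
  simp only [Set.ofPred_and, Set.ofPred_forall]
  refine (isClosed_iInter fun i => isClosed_iInter fun j => isClosed_iInter fun _ =>
    isClosed_le (continuous_apply j) (continuous_apply i)).inter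
    ((isClosed_iInter fun i => isClosed_le continuous_const (continuous_apply i)).inter
      (isClosed_iInter fun N => isClosed_le (by fun_prop) continuous_const))

instance compactSpace_simplex : CompactSpace simplex := by
  rw [← isCompact_iff_compactSpace]
  refine (isCompact_univ_pi fun _ : ℕ => isCompact_Icc (a := (0 : ℝ)) (b := 1)).of_isClosed_subset
    isClosed_simplex fun α hα i _ => ⟨hα.2.1 i, simplex_le_one ⟨α, hα⟩ i⟩

/-- Adding the gap makes degree `1` constant; in higher degrees the series is dominated by `∑ (1 /
(i + 1)) ^ (k + 1)`. -/
theorem continuous_extPowerSum (k : ℕ) : Continuous fun α : simplex => extPowerSum α (k + 1) := by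
  rcases Nat.eq_zero_or_pos k with rfl | hk
  · simp only [zero_add, extPowerSum_one]
    exact continuous_const
  · simp only [extPowerSum_of_ne_one _ (show k + 1 ≠ 1 by omega)]
    refine continuous_tsum (u := fun i : ℕ => (1 / ((i : ℝ) + 1)) ^ (k + 1))
      (fun i => ((continuous_apply i).comp continuous_subtype_val).pow _) ?_ fun i α => ?_
    · have h := (summable_nat_add_iff 1).2
        (Real.summable_one_div_nat_pow (p := k + 1).2 (by omega))
      simpa using h
    · rw [Real.norm_of_nonneg (pow_nonneg (α.2.2.1 i) _)]
      exact pow_le_pow_left₀ (α.2.2.1 i) (simplex_le_one_div α i) _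

/-- The extended power sums, as bounded continuous functions. -/
def extPowerSumBCF (k : ℕ) : BoundedContinuousFunction simplex ℝ :=
  BoundedContinuousFunction.mkOfCompact ⟨_, continuous_extPowerSum k⟩

/-- The extended version of a symmetric function, as a bounded continuous function. -/
def extendedHom : SymmFun →ₐ[ℝ] BoundedContinuousFunction simplex ℝ :=
  MvPolynomial.aeval extPowerSumBCF

theorem extendedHom_apply (F : SymmFun) (α : simplex) : extendedHom F α = extended F α := by
  induction F using MvPolynomial.induction_on with
  | C c => simp [extendedHom, extended]
  | add F G hF hG => simp only [extended, map_add] at *; simp [hF, hG]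
  | mul_X F k hF =>
    simp only [extended, map_mul] at *
    rw [BoundedContinuousFunction.mul_apply, hF]
    simp [extendedHom, extPowerSumBCF]

theorem continuous_extended (F : SymmFun) : Continuous (extended F) := by
  rw [← funext (extendedHom_apply F)]
  exact (extendedHom F).continuous

theorem integrable_extended (F : SymmFun) (P : Measure simplex) [IsFiniteMeasure P] :
    Integrable (extended F) P := by
  rw [← funext (extendedHom_apply F)]
  exact (extendedHom F).integrable P

/-- If `β_m < α_m`, comparing the tails of the power sums gives `α_m ^ (k + 2) ≤ β_m ^ (k + 1)`, so
`α_m ≤ (β_m / α_m) ^ (k + 1)`, which tends to `0`. -/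
theorem simplex_coord_le_of_powerSum_eq {α β : simplex}
    (h : ∀ k, 2 ≤ k → ∑' i, α.1 i ^ k = ∑' i, β.1 i ^ k) (m : ℕ)
    (hm : ∀ i < m, α.1 i = β.1 i) : α.1 m ≤ β.1 m := by
  by_contra! hlt
  have hβ0 := β.2.2.1 m
  have hα0 : 0 < α.1 m := hβ0.trans_lt hlt
  have key : ∀ k : ℕ, α.1 m ^ (k + 2) ≤ β.1 m ^ (k + 1) := by
    intro k
    have hsa := summable_simplex_pow α (m := k + 2) (by omega)
    have hsb := summable_simplex_pow β (m := k + 2) (by omega)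
    have h1 := h (k + 2) (by omega)
    rw [← hsa.sum_add_tsum_nat_add m, ← hsb.sum_add_tsum_nat_add m,
      Finset.sum_congr rfl fun i hi => by rw [hm i (Finset.mem_range.1 hi)], add_right_inj] at h1
    have h2 : α.1 m ^ (k + 2) ≤ ∑' i, α.1 (i + m) ^ (k + 2) := by
      have := ((summable_nat_add_iff m).2 hsa).le_tsum 0 fun i _ => pow_nonneg (α.2.2.1 _) _
      simpa using this
    have h3 : ∑' i, β.1 (i + m) ^ (k + 2) ≤ ∑' i, β.1 m ^ (k + 1) * β.1 (i + m) := by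
      refine ((summable_nat_add_iff m).2 hsb).tsum_le_tsum (fun i => ?_)
        (((summable_nat_add_iff m).2 β.2.2.2.1).mul_left _)
      rw [pow_succ]
      exact mul_le_mul_of_nonneg_right
        (pow_le_pow_left₀ (β.2.2.1 _) (β.2.1 (Nat.le_add_left m i)) _) (β.2.2.1 _)
    rw [tsum_mul_left] at h3
    have h4 : ∑' i, β.1 (i + m) ≤ 1 := by
      refine le_trans ?_ β.2.2.2.2
      rw [← β.2.2.2.1.sum_add_tsum_nat_add m]
      exact le_add_of_nonneg_left (Finset.sum_nonneg fun i _ => β.2.2.1 i)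
    calc α.1 m ^ (k + 2) ≤ β.1 m ^ (k + 1) * ∑' i, β.1 (i + m) := h2.trans (h1.le.trans h3)
      _ ≤ β.1 m ^ (k + 1) := mul_le_of_le_one_right (pow_nonneg hβ0 _) h4
  have hr : Tendsto (fun k : ℕ => (β.1 m / α.1 m) ^ (k + 1)) atTop (𝓝 0) :=
    (tendsto_pow_atTop_nhds_zero_of_lt_one (div_nonneg hβ0 hα0.le)
      ((div_lt_one hα0).2 hlt)).comp (tendsto_add_atTop_nat 1)
  refine absurd (ge_of_tendsto' hr fun k => ?_) (not_le.2 hα0)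
  rw [div_pow, le_div_iff₀ (by positivity), ← pow_succ']
  exact key k

/-- A point of the simplex is determined by its power sums of degree at least `2`. -/
theorem simplex_ext_powerSum {α β : simplex}
    (h : ∀ k, 2 ≤ k → ∑' i, α.1 i ^ k = ∑' i, β.1 i ^ k) : α = β := by
  refine Subtype.ext (funext fun m => ?_)
  induction m using Nat.strong_induction_on with
  | _ m ih =>
    exact le_antisymm (simplex_coord_le_of_powerSum_eq h m ih)
      (simplex_coord_le_of_powerSum_eq (fun k hk => (h k hk).symm) m fun i hi => (ih i hi).symm)

/-- A finite measure on the simplex is determined by the integrals of the extended versions of the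
augmented monomial symmetric functions. -/
theorem measure_simplex_ext {P Q : Measure simplex} [IsFiniteMeasure P] [IsFiniteMeasure Q]
    (h : ∀ k b, ∫ α, extended (augMonomial k b) α ∂P = ∫ α, extended (augMonomial k b) α ∂Q) :
    P = Q := by
  have hall : ∀ F : SymmFun, ∫ α, extended F α ∂P = ∫ α, extended F α ∂Q := by
    intro F
    have hF : F ∈ Submodule.span ℝ {F : SymmFun | ∃ k b, F = augMonomial k b} := by
      rw [span_augMonomial]; trivial
    induction hF using Submodule.span_induction with
    | mem F hF => obtain ⟨k, b, rfl⟩ := hF; exact h k b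
    | zero => simp [extended]
    | add F G _ _ hF hG =>
      have : extended (F + G) = extended F + extended G := by ext; simp [extended]
      simp only [this]
      rw [integral_add' (integrable_extended F P) (integrable_extended G P),
        integral_add' (integrable_extended F Q) (integrable_extended G Q), hF, hG]
    | smul c F _ hF =>
      simp only [extended, map_smul, smul_eq_mul, integral_const_mul] at *
      rw [hF]
  let A : StarSubalgebra ℝ (BoundedContinuousFunction simplex ℝ) :=
    { extendedHom.range with
      star_mem' := by
        intro f hf
        have : star f = f := by ext; simp
        rwa [this] }
  have : PolishSpace simplex := isClosed_simplex.polishSpace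
  refine ext_of_forall_mem_subalgebra_integral_eq_of_polish (𝕜 := ℝ) (A := A) ?_ ?_
  · intro α β hαβ
    by_contra hcon
    refine hαβ (simplex_ext_powerSum fun k hk => ?_)
    by_contra hne
    refine hcon ⟨_, ⟨extPowerSumBCF (k - 1), ⟨extendedHom (MvPolynomial.X (k - 1)),
      ⟨_, rfl⟩, ?_⟩, rfl⟩, ?_⟩
    · simp [extendedHom]
      rfl
    · simp only [extPowerSumBCF, BoundedContinuousFunction.mkOfCompact_apply,
        ContinuousMap.coe_mk]
      rw [Nat.sub_add_cancel (by omega), extPowerSum_of_ne_one _ (by omega),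
        extPowerSum_of_ne_one _ (by omega)]
      exact hne
  · rintro f ⟨F, rfl⟩
    have := hall F
    rw [← funext (extendedHom_apply F)] at this
    exact this

/-! ### Dirichlet integrals -/

theorem posPow_nonneg (y s : ℝ) : 0 ≤ posPow y s := by
  unfold posPow
  split_ifs with h
  · exact Real.rpow_nonneg h.le s
  · exact le_rfl

theorem posPow_of_pos {y : ℝ} (hy : 0 < y) (s : ℝ) : posPow y s = y ^ s := if_pos hy

theorem posPow_of_nonpos {y : ℝ} (hy : y ≤ 0) (s : ℝ) : posPow y s = 0 := if_neg hy.not_gt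

theorem posPow_mul_left {c : ℝ} (hc : 0 < c) (y s : ℝ) : posPow (c * y) s = c ^ s * posPow y s := by
  rcases le_or_gt y 0 with hy | hy
  · rw [posPow_of_nonpos hy, posPow_of_nonpos (mul_nonpos_of_nonneg_of_nonpos hc.le hy), mul_zero]
  · rw [posPow_of_pos hy, posPow_of_pos (mul_pos hc hy), Real.mul_rpow hc.le hy.le]

theorem posPow_mul_pow {y : ℝ} (s : ℝ) (m : ℕ) : posPow y s * y ^ m = posPow y (s + m) := by
  rcases le_or_gt y 0 with hy | hy
  · rw [posPow_of_nonpos hy, posPow_of_nonpos hy, zero_mul]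
  · rw [posPow_of_pos hy, posPow_of_pos hy, Real.rpow_add hy, Real.rpow_natCast]

@[fun_prop]
theorem measurable_posPow (s : ℝ) : Measurable fun y => posPow y s :=
  Measurable.ite measurableSet_Ioi (by fun_prop) measurable_const

/-- For `c > 0`, scaling by `c` reduces this to the normalization of the beta density; for `c ≤ 0`
both sides vanish. -/
theorem lintegral_posPow_mul_posPow {a s : ℝ} (ha : 0 < a) (hs : 0 < s) (c : ℝ) :
    ∫⁻ x, ENNReal.ofReal (posPow x (a - 1) * posPow (c - x) (s - 1)) =
      ENNReal.ofReal (posPow c (a + s - 1) *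
        (Real.Gamma a * Real.Gamma s / Real.Gamma (a + s))) := by
  rcases le_or_gt c 0 with hc | hc
  · rw [posPow_of_nonpos hc, zero_mul, ENNReal.ofReal_zero]
    convert lintegral_zero (μ := (volume : Measure ℝ)) with x
    rcases le_or_gt x 0 with hx | hx
    · rw [posPow_of_nonpos hx, zero_mul, ENNReal.ofReal_zero]
    · rw [posPow_of_nonpos (y := c - x) (by linarith), mul_zero, ENNReal.ofReal_zero]
  · have hB : 0 < ProbabilityTheory.beta a s := ProbabilityTheory.beta_pos ha hs
    have hpdf : ∀ x, posPow x (a - 1) * posPow (1 - x) (s - 1) =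
        ProbabilityTheory.beta a s * ProbabilityTheory.betaPDFReal a s x := by
      intro x
      unfold ProbabilityTheory.betaPDFReal
      split_ifs with h
      · rw [posPow_of_pos h.1, posPow_of_pos (by linarith [h.2])]
        field_simp
      · rcases le_or_gt x 0 with hx | hx
        · rw [posPow_of_nonpos hx, zero_mul, mul_zero]
        · have : ¬ x < 1 := fun h' => h ⟨hx, h'⟩
          rw [posPow_of_nonpos (y := 1 - x) (by linarith), mul_zero, mul_zero]
    have hg : ∀ x, ENNReal.ofReal (posPow (c * x) (a - 1) * posPow (c - c * x) (s - 1)) =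
        ENNReal.ofReal (c ^ (a - 1) * c ^ (s - 1) * ProbabilityTheory.beta a s) *
          ProbabilityTheory.betaPDF a s x := by
      intro x
      rw [show c - c * x = c * (1 - x) by ring, posPow_mul_left hc, posPow_mul_left hc,
        ProbabilityTheory.betaPDF, ← ENNReal.ofReal_mul (by positivity)]
      congr 1
      linear_combination c ^ (a - 1) * c ^ (s - 1) * hpdf x
    rw [← Real.smul_map_volume_mul_left hc.ne', lintegral_smul_measure,
      lintegral_map (by fun_prop) (by fun_prop)]
    simp only [hg]
    rw [lintegral_const_mul' _ _ ENNReal.ofReal_ne_top,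
      ProbabilityTheory.lintegral_betaPDF_eq_one ha hs, mul_one, smul_eq_mul,
      ← ENNReal.ofReal_mul (abs_nonneg c), abs_of_pos hc, posPow_of_pos hc,
      ← mul_assoc, ← mul_assoc]
    congr 2
    rw [← Real.rpow_one_add' hc.le (by linarith), ← Real.rpow_add hc]
    congr 1
    ring

/-- The **Dirichlet integral**. -/
theorem lintegral_dirichlet {n : ℕ} (a : Fin n → ℝ) (ha : ∀ i, 0 < a i) {s : ℝ} (hs : 0 < s)
    (c : ℝ) :
    ∫⁻ x : Fin n → ℝ, ENNReal.ofReal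
        ((∏ i, posPow (x i) (a i - 1)) * posPow (c - ∑ i, x i) (s - 1)) =
      ENNReal.ofReal (posPow c (∑ i, a i + s - 1) *
        ((∏ i, Real.Gamma (a i)) * Real.Gamma s / Real.Gamma (∑ i, a i + s))) := by
  induction n generalizing c with
  | zero =>
    have := (Real.Gamma_pos_of_pos hs).ne'
    rw [volume_pi, Measure.pi_of_empty (x := Fin.elim0)]
    simp [this]
  | succ n ih =>
    -- Fixing the coordinate `0` at `y` leaves an integral of the same kind with `c - y` in place of
    -- `c`; its value, a power of `c - y`, makes the outer integral a beta integral.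
    rw [← (volume_preserving_piFinSuccAbove (fun _ : Fin (n + 1) => ℝ) 0).symm.lintegral_comp
      (by fun_prop), Measure.volume_eq_prod, lintegral_prod _ (by fun_prop)]
    have hsum : 0 < ∑ i : Fin n, a i.succ + s :=
      add_pos_of_nonneg_of_pos (Finset.sum_nonneg fun i _ => (ha _).le) hs
    have hA : ∀ (y : ℝ) (x : Fin n → ℝ),
        ENNReal.ofReal ((∏ i, posPow ((MeasurableEquiv.piFinSuccAbove
          (fun _ : Fin (n + 1) => ℝ) 0).symm (y, x) i) (a i - 1)) *
          posPow (c - ∑ i, (MeasurableEquiv.piFinSuccAbove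
          (fun _ : Fin (n + 1) => ℝ) 0).symm (y, x) i) (s - 1)) =
        ENNReal.ofReal (posPow y (a 0 - 1)) * ENNReal.ofReal
          ((∏ i, posPow (x i) (a i.succ - 1)) * posPow (c - y - ∑ i, x i) (s - 1)) := by
      intro y x
      rw [← ENNReal.ofReal_mul (posPow_nonneg _ _)]
      simp [MeasurableEquiv.piFinSuccAbove_symm_apply, Fin.prod_univ_succ, Fin.sum_univ_succ,
        mul_assoc, sub_sub]
    simp only [hA]
    set K := (∏ i : Fin n, Real.Gamma (a i.succ)) * Real.Gamma s /
      Real.Gamma (∑ i : Fin n, a i.succ + s) with hK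
    have hK0 : 0 ≤ K := by
      have h1 := Real.Gamma_pos_of_pos hs
      have h2 := Real.Gamma_pos_of_pos hsum
      have h3 : 0 ≤ ∏ i : Fin n, Real.Gamma (a i.succ) :=
        Finset.prod_nonneg fun i _ => (Real.Gamma_pos_of_pos (ha _)).le
      positivity
    have hB : ∀ y : ℝ, ∫⁻ x : Fin n → ℝ, ENNReal.ofReal (posPow y (a 0 - 1)) * ENNReal.ofReal
          ((∏ i, posPow (x i) (a i.succ - 1)) * posPow (c - y - ∑ i, x i) (s - 1)) =
        ENNReal.ofReal K * ENNReal.ofReal (posPow y (a 0 - 1) *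
          posPow (c - y) (∑ i : Fin n, a i.succ + s - 1)) := by
      intro y
      rw [lintegral_const_mul' _ _ ENNReal.ofReal_ne_top,
        ih (fun i => a i.succ) (fun i => ha _), ← ENNReal.ofReal_mul (posPow_nonneg _ _),
        ← ENNReal.ofReal_mul hK0]
      congr 1
      ring
    simp only [hB]
    rw [lintegral_const_mul' _ _ ENNReal.ofReal_ne_top,
      lintegral_posPow_mul_posPow (ha 0) hsum, ← ENNReal.ofReal_mul hK0, Fin.prod_univ_succ,
      Fin.sum_univ_succ, hK]
    have := (Real.Gamma_pos_of_pos hsum).ne'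
    congr 1
    rw [← add_assoc]
    field_simp

theorem Gamma_add_nat {t : ℝ} (ht : 0 < t) (n : ℕ) :
    Real.Gamma (t + n) = (ascPochhammer ℝ n).eval t * Real.Gamma t := by
  induction n with
  | zero => simp
  | succ n ih =>
    rw [ascPochhammer_succ_eval, Nat.cast_succ, ← add_assoc, Real.Gamma_add_one (by positivity), ih]
    ring

/-! ### Ranked Dirichlet distributions -/

/-- The entries of a tuple in decreasing order, followed by zeros. -/
def rankedSeq {N : ℕ} (v : Fin N → ℝ) (i : ℕ) : ℝ :=
  if h : i < N then v (Tuple.sort (-v) ⟨i, h⟩) else 0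

theorem antitone_comp_sort_neg {N : ℕ} (v : Fin N → ℝ) :
    Antitone fun i => v (Tuple.sort (-v) i) := fun i j hij => by
  have := Tuple.monotone_sort (-v) hij
  simpa using this

theorem tsum_rankedSeq_pow {N : ℕ} (v : Fin N → ℝ) (m : ℕ) (hm : m ≠ 0) :
    ∑' i, rankedSeq v i ^ m = ∑ i, v i ^ m := by
  rw [tsum_eq_sum (s := Finset.range N)
    fun i hi => by simp [rankedSeq, Finset.mem_range.not.1 hi, hm],
    Finset.sum_range, ← Equiv.sum_comp (Tuple.sort (-v)) fun i => v i ^ m]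
  simp [rankedSeq]

theorem rankedSeq_mem_simplex {N : ℕ} {v : Fin N → ℝ} (hv : ∀ i, 0 ≤ v i)
    (hs : ∑ i, v i = 1) : rankedSeq v ∈ simplex := by
  have h0 : ∀ i, 0 ≤ rankedSeq v i := fun i => by
    unfold rankedSeq
    split_ifs
    · exact hv _
    · exact le_rfl
  refine ⟨fun i j hij => ?_, h0, ?_, ?_⟩
  · by_cases hj : j < N
    · have hi : i < N := hij.trans_lt hj
      simp only [rankedSeq, hi, hj, dif_pos]
      exact antitone_comp_sort_neg v (show (⟨i, hi⟩ : Fin N) ≤ ⟨j, hj⟩ from hij)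
    · have : rankedSeq v j = 0 := by simp [rankedSeq, hj]
      rw [this]
      exact h0 i
  · exact summable_of_ne_finset_zero (s := Finset.range N)
      fun i hi => by simp [rankedSeq, Finset.mem_range.not.1 hi]
  · have := tsum_rankedSeq_pow v 1 one_ne_zero
    simp only [pow_one] at this
    rw [this, hs]

/-- The entry of rank `i` (counted from `0`) exceeds `a` iff more than `i` entries do, so the
sorting permutation itself need not be measurable. -/
theorem measurable_rankedSeq {N : ℕ} : Measurable (rankedSeq : (Fin N → ℝ) → ℕ → ℝ) := by
  refine measurable_pi_lambda _ fun i => ?_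
  by_cases h : i < N
  · simp only [rankedSeq, h, dif_pos]
    refine measurable_of_Ioi fun a => ?_
    have hset : (fun v : Fin N → ℝ => v (Tuple.sort (-v) ⟨i, h⟩)) ⁻¹' Set.Ioi a =
        {v : Fin N → ℝ | i < ∑ j, if a < v j then 1 else 0} := by
      ext v
      have h1 := Tuple.lt_card_gt_iff_apply_gt_of_antitone (j := ⟨i, h⟩) (a := a)
        (antitone_comp_sort_neg v)
      rw [Set.mem_preimage, Set.mem_Ioi, ← h1, Finset.card_filter,
        Equiv.sum_comp (Tuple.sort (-v)) fun j => if a < v j then 1 else 0]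
      rfl
    rw [hset]
    refine measurableSet_lt measurable_const (Finset.measurable_sum _ fun j _ => ?_)
    exact Measurable.ite (measurableSet_lt measurable_const (measurable_pi_apply j))
      measurable_const measurable_const
  · simp only [rankedSeq, h, dif_neg, not_false_eq_true]
    exact measurable_const

theorem zero_mem_simplex : (0 : ℕ → ℝ) ∈ simplex :=
  ⟨fun _ _ _ => le_rfl, fun _ => le_rfl, summable_zero, by simp⟩

open Classical in
/-- The point of the simplex obtained by ranking the entries of a nonnegative tuple with
sum `1`. -/
def rankedPoint {N : ℕ} (v : Fin N → ℝ) : simplex :=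
  ⟨if (∀ i, 0 ≤ v i) ∧ ∑ i, v i = 1 then rankedSeq v else 0, by
    split_ifs with h
    · exact rankedSeq_mem_simplex h.1 h.2
    · exact zero_mem_simplex⟩

theorem measurable_rankedPoint {N : ℕ} : Measurable (rankedPoint : (Fin N → ℝ) → simplex) := by
  refine Measurable.subtype_mk (Measurable.ite ?_ measurable_rankedSeq measurable_const)
  have h : MeasurableSet {v : Fin N → ℝ | ∀ i, 0 ≤ v i} := by
    rw [Set.ofPred_forall]
    exact MeasurableSet.iInter fun i => measurableSet_le measurable_const (measurable_pi_apply i)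
  exact h.inter (measurableSet_eq_fun (by fun_prop) measurable_const)

/-- A total mass of `1` leaves no gap, so extended and ordinary power sums agree. -/
theorem extended_rankedPoint {N : ℕ} {v : Fin N → ℝ} (hv : ∀ i, 0 ≤ v i)
    (hs : ∑ i, v i = 1) (F : SymmFun) :
    extended F (rankedPoint v) = MvPolynomial.eval v (realize N F) := by
  rw [eval_realize, extended, MvPolynomial.aeval_eq_eval]
  congr 2
  ext k
  rcases Nat.eq_zero_or_pos k with rfl | hk
  · simp [extPowerSum_one, hs]
  · rw [extPowerSum_of_ne_one _ (by omega), ← tsum_rankedSeq_pow v _ (Nat.succ_ne_zero k)]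
    simp [rankedPoint, hv, hs]

/-- The symmetric Dirichlet distribution with `N + 1` parameters equal to `θ`, as the joint law of
the last `N` coordinates. -/
def dirichletMeasure (θ : ℝ) (N : ℕ) : Measure (Fin N → ℝ) :=
  volume.withDensity fun x => ENNReal.ofReal
    (Real.Gamma ((N + 1) * θ) / Real.Gamma θ ^ (N + 1) *
      ((∏ i, posPow (x i) (θ - 1)) * posPow (1 - ∑ i, x i) (θ - 1)))

/-- All the coordinates of a point of the standard simplex from all but the first one. -/
def completeTuple {N : ℕ} (x : Fin N → ℝ) : Fin (N + 1) → ℝ := Fin.cons (1 - ∑ i, x i) x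

theorem measurable_completeTuple {N : ℕ} :
    Measurable (completeTuple : (Fin N → ℝ) → Fin (N + 1) → ℝ) := by
  refine measurable_pi_lambda _ fun i => ?_
  refine Fin.cases ?_ (fun i => ?_) i
  · simp only [completeTuple, Fin.cons_zero]; fun_prop
  · simp only [completeTuple, Fin.cons_succ]; fun_prop

theorem sum_completeTuple {N : ℕ} (x : Fin N → ℝ) : ∑ i, completeTuple x i = 1 := by
  simp [completeTuple, Fin.sum_univ_succ]

theorem ae_completeTuple_nonneg (θ : ℝ) (N : ℕ) :
    ∀ᵐ x ∂dirichletMeasure θ N, ∀ i, 0 ≤ completeTuple x i := by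
  rw [dirichletMeasure, ae_withDensity_iff (by fun_prop)]
  refine Eventually.of_forall fun x hx => ?_
  have h : (∏ i, posPow (x i) (θ - 1)) * posPow (1 - ∑ i, x i) (θ - 1) ≠ 0 := by
    intro h
    rw [h, mul_zero, ENNReal.ofReal_zero] at hx
    exact hx rfl
  intro i
  by_contra! hi
  refine Fin.cases (fun hi => h ?_) (fun i hi => h ?_) i hi
  · simp only [completeTuple, Fin.cons_zero] at hi
    rw [posPow_of_nonpos hi.le, mul_zero]
  · simp only [completeTuple, Fin.cons_succ] at hi
    rw [Finset.prod_eq_zero (Finset.mem_univ i) (posPow_of_nonpos hi.le _), zero_mul]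

/-- The monomial shifts the Dirichlet parameters from `θ` to `θ + c i`; the quotients of Gamma
values are rising factorials. -/
theorem lintegral_dirichletMeasure {θ : ℝ} (hθ : 0 < θ) {N : ℕ} (c : Fin (N + 1) → ℕ) :
    ∫⁻ x, ENNReal.ofReal (∏ i, completeTuple x i ^ c i) ∂dirichletMeasure θ N =
      ENNReal.ofReal ((∏ i, (ascPochhammer ℝ (c i)).eval θ) /
        (ascPochhammer ℝ (∑ i, c i)).eval ((N + 1) * θ)) := by
  have hN : 0 < ((N : ℝ) + 1) * θ := by positivity
  have hG := Real.Gamma_pos_of_pos hθ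
  have hGN := Real.Gamma_pos_of_pos hN
  have hZ : 0 ≤ Real.Gamma ((N + 1) * θ) / Real.Gamma θ ^ (N + 1) := by positivity
  have hm : Measurable fun x : Fin N → ℝ => ENNReal.ofReal (∏ i, completeTuple x i ^ c i) :=
    (Finset.measurable_prod _ fun i _ =>
      ((measurable_pi_apply i).comp measurable_completeTuple).pow_const _).ennreal_ofReal
  rw [dirichletMeasure, lintegral_withDensity_eq_lintegral_mul _ (by fun_prop) hm]
  have hint : ∀ x : Fin N → ℝ,
      ENNReal.ofReal (Real.Gamma ((N + 1) * θ) / Real.Gamma θ ^ (N + 1) *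
        ((∏ i, posPow (x i) (θ - 1)) * posPow (1 - ∑ i, x i) (θ - 1))) *
        ENNReal.ofReal (∏ i, completeTuple x i ^ c i) =
      ENNReal.ofReal (Real.Gamma ((N + 1) * θ) / Real.Gamma θ ^ (N + 1)) *
        ENNReal.ofReal ((∏ i, posPow (x i) ((θ + c i.succ) - 1)) *
          posPow (1 - ∑ i, x i) ((θ + c 0) - 1)) := by
    intro x
    rw [← ENNReal.ofReal_mul (mul_nonneg hZ (mul_nonneg
      (Finset.prod_nonneg fun i _ => posPow_nonneg _ _) (posPow_nonneg _ _))),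
      ← ENNReal.ofReal_mul hZ]
    congr 1
    simp only [add_sub_right_comm, ← posPow_mul_pow, Finset.prod_mul_distrib,
      Fin.prod_univ_succ, completeTuple, Fin.cons_zero, Fin.cons_succ]
    ring
  simp only [Pi.mul_apply, hint]
  rw [lintegral_const_mul' _ _ ENNReal.ofReal_ne_top,
    lintegral_dirichlet _ (fun i => by positivity) (by positivity), ← ENNReal.ofReal_mul hZ,
    posPow_of_pos one_pos, Real.one_rpow, one_mul]
  congr 1
  have hsum : ∑ i : Fin N, (θ + c i.succ) + (θ + c 0) = (N + 1) * θ + (∑ i, c i : ℕ) := by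
    rw [Fin.sum_univ_succ, Finset.sum_add_distrib]
    push_cast
    simp
    ring
  have hpos := ascPochhammer_pos (∑ i, c i) _ hN
  rw [hsum, Gamma_add_nat hN]
  simp only [Gamma_add_nat hθ, Finset.prod_mul_distrib]
  rw [Fin.prod_univ_succ, Finset.prod_const, Finset.card_univ, Fintype.card_fin]
  field_simp
  ring

theorem isProbabilityMeasure_dirichletMeasure {θ : ℝ} (hθ : 0 < θ) (N : ℕ) :
    IsProbabilityMeasure (dirichletMeasure θ N) := by
  constructor
  have h := lintegral_dirichletMeasure hθ (N := N) fun _ => 0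
  simpa using h

theorem prod_count_tupleMultiset {M : Type*} [CommMonoid M] {σ : Type*} [Fintype σ]
    [DecidableEq σ] {k : ℕ} (b : Fin k → ℕ) (f : Fin k ↪ σ) (g : σ → ℕ → M)
    (hg : ∀ i, g i 0 = 1) :
    ∏ i, g i ((tupleMultiset b f).count i) = ∏ j, g (f j) (b j + 1) := by
  rw [← Finset.prod_subset (Finset.subset_univ (Finset.univ.map f)), Finset.prod_map]
  · exact Finset.prod_congr rfl fun j _ => by rw [count_tupleMultiset]
  · intro i _ hi
    have : i ∉ tupleMultiset b f := by
      rw [mem_tupleMultiset]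
      simpa using hi
    rw [Multiset.count_eq_zero.2 this, hg]

theorem integral_tupleMonomial_dirichletMeasure {θ : ℝ} (hθ : 0 < θ) {N k : ℕ}
    (b : Fin k → ℕ) (f : Fin k ↪ Fin (N + 1)) :
    Integrable (fun x => tupleMonomial b (completeTuple x) f) (dirichletMeasure θ N) ∧
    ∫ x, tupleMonomial b (completeTuple x) f ∂dirichletMeasure θ N =
      (∏ j, (ascPochhammer ℝ (b j + 1)).eval θ) /
        (ascPochhammer ℝ (∑ j, (b j + 1))).eval ((N + 1) * θ) := by
  have h := lintegral_dirichletMeasure hθ (N := N) fun i => (tupleMultiset b f).count i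
  have hN : 0 < ((N : ℝ) + 1) * θ := by positivity
  rw [prod_count_tupleMultiset b f (fun _ m => (ascPochhammer ℝ m).eval θ) (by simp),
    Multiset.sum_count_eq_card (s := Finset.univ) (by simp), card_tupleMultiset] at h
  simp only [fun x : Fin N → ℝ => prod_count_tupleMultiset b f
    (fun i m => completeTuple x i ^ m) (by simp)] at h
  have hm : Measurable fun x : Fin N → ℝ => tupleMonomial b (completeTuple x) f :=
    Finset.measurable_prod _ fun j _ =>
      ((measurable_pi_apply (f j)).comp measurable_completeTuple).pow_const _
  have hnn : 0 ≤ᵐ[dirichletMeasure θ N] fun x => tupleMonomial b (completeTuple x) f := by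
    filter_upwards [ae_completeTuple_nonneg θ N] with x hx
    exact Finset.prod_nonneg fun j _ => pow_nonneg (hx _) _
  constructor
  · refine ⟨hm.aestronglyMeasurable, ?_⟩
    rw [hasFiniteIntegral_iff_ofReal hnn]
    exact h.trans_lt ENNReal.ofReal_lt_top
  · rw [integral_eq_lintegral_of_nonneg_ae hnn hm.aestronglyMeasurable]
    refine (congrArg ENNReal.toReal h).trans (ENNReal.toReal_ofReal ?_)
    exact div_nonneg (Finset.prod_nonneg fun j _ => (ascPochhammer_pos _ _ hθ).le)
      (ascPochhammer_pos _ _ hN).le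

/-- The law of the ranked coordinates of a Dirichlet distributed point. -/
def rankedDirichlet (θ : ℝ) (N : ℕ) : Measure simplex :=
  (dirichletMeasure θ N).map fun x => rankedPoint (completeTuple x)

theorem isProbabilityMeasure_rankedDirichlet {θ : ℝ} (hθ : 0 < θ) (N : ℕ) :
    IsProbabilityMeasure (rankedDirichlet θ N) :=
  have := isProbabilityMeasure_dirichletMeasure hθ N
  Measure.isProbabilityMeasure_map
    (measurable_rankedPoint.comp measurable_completeTuple).aemeasurable

/-- By symmetry all injections `Fin k ↪ Fin (N + 1)` contribute equally; the falling factorial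
counts them. -/
theorem integral_rankedDirichlet {θ : ℝ} (hθ : 0 < θ) (N : ℕ) {k : ℕ} (b : Fin k → ℕ) :
    ∫ α, extended (augMonomial k b) α ∂rankedDirichlet θ N =
      ((N + 1).descFactorial k : ℝ) * ((∏ j, (ascPochhammer ℝ (b j + 1)).eval θ) /
        (ascPochhammer ℝ (∑ j, (b j + 1))).eval ((N + 1) * θ)) := by
  have hm : Measurable fun x : Fin N → ℝ => rankedPoint (completeTuple x) :=
    measurable_rankedPoint.comp measurable_completeTuple
  rw [rankedDirichlet, integral_map hm.aemeasurable
    (continuous_extended _).aestronglyMeasurable]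
  have h : (fun x : Fin N → ℝ => extended (augMonomial k b) (rankedPoint (completeTuple x)))
      =ᵐ[dirichletMeasure θ N] fun x =>
        ∑ f : Fin k ↪ Fin (N + 1), tupleMonomial b (completeTuple x) f := by
    filter_upwards [ae_completeTuple_nonneg θ N] with x hx
    rw [extended_rankedPoint hx (sum_completeTuple x), realize_augMonomial, map_sum]
    simp [tupleMonomial]
  rw [integral_congr_ae h, integral_finsetSum _ fun f _ =>
    (integral_tupleMonomial_dirichletMeasure hθ b f).1]
  simp only [fun f => (integral_tupleMonomial_dirichletMeasure hθ (N := N) b f).2]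
  rw [Finset.sum_const, Finset.card_univ, Fintype.card_embedding_eq]
  simp

/-- With `θ = t / (N + 1)` the denominator is constantly `(t)_n`. Since `(θ)_{b+1} = θ (θ + 1)_b`,
the `k` factors `θ` balance the falling factorial, and `(θ + 1)_b → b!`. -/
theorem tendsto_integral_rankedDirichlet {t : ℝ} (ht : 0 < t) {k : ℕ} (b : Fin k → ℕ) :
    Tendsto (fun N : ℕ => ∫ α, extended (augMonomial k b) α ∂rankedDirichlet (t / (N + 1)) N)
      atTop (𝓝 (ewensMoment t b)) := by
  have hθ : Tendsto (fun N : ℕ => t / ((N : ℝ) + 1)) atTop (𝓝 0) :=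
    tendsto_const_nhds.div_atTop (tendsto_atTop_add_const_right _ _ tendsto_natCast_atTop_atTop)
  have hdesc : Tendsto (fun N : ℕ => ((N + 1).descFactorial k : ℝ) / ((N : ℝ) + 1) ^ k) atTop
      (𝓝 1) := by
    have h1 := (Asymptotics.isEquivalent_iff_tendsto_one (by
      filter_upwards [eventually_gt_atTop 0] with n hn
      positivity)).1 (isEquivalent_descFactorial k)
    have h2 := h1.comp (tendsto_add_atTop_nat 1)
    refine h2.congr fun N => ?_
    simp
  have hpoch : ∀ j, Tendsto (fun N : ℕ => t * (ascPochhammer ℝ (b j)).eval (t / ((N : ℝ) + 1) + 1))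
      atTop (𝓝 (t * ((b j).factorial : ℝ))) := by
    intro j
    refine tendsto_const_nhds.mul ?_
    have h := ((ascPochhammer ℝ (b j)).continuous.tendsto 1).comp
      ((hθ.add_const 1).trans (by rw [zero_add]))
    rwa [ascPochhammer_eval_one] at h
  have hlim := (hdesc.mul (tendsto_finsetProd Finset.univ fun j _ => hpoch j)).div_const
    ((ascPochhammer ℝ (∑ j, (b j + 1))).eval t)
  have hval : 1 * (∏ j, t * ((b j).factorial : ℝ)) / (ascPochhammer ℝ (∑ j, (b j + 1))).eval t =
      ewensMoment t b := by
    rw [ewensMoment, one_mul, Finset.prod_mul_distrib]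
    simp
  rw [hval] at hlim
  refine hlim.congr fun N => ?_
  have hN : (0 : ℝ) < N + 1 := by positivity
  rw [integral_rankedDirichlet (div_pos ht hN), mul_div_cancel₀ _ hN.ne', mul_div_assoc]
  simp only [ascPochhammer_succ_left, Polynomial.eval_mul, Polynomial.eval_X,
    Polynomial.eval_comp, Polynomial.eval_add, Polynomial.eval_one, Finset.prod_mul_distrib,
    Finset.prod_const, Finset.card_univ, Fintype.card_fin, div_pow]
  field_simp

/-! ### Existence and uniqueness of the Poisson–Dirichlet distribution. -/

theorem exists_isPD {t : ℝ} (ht : 0 < t) : ∃ P : Measure simplex, IsPD t P := by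
  let Q : ℕ → ProbabilityMeasure simplex := fun N =>
    ⟨rankedDirichlet (t / (N + 1)) N, isProbabilityMeasure_rankedDirichlet (by positivity) N⟩
  -- Probability measures on the compact simplex form a compact space, so a limit along an
  -- ultrafilter exists; extended functions are continuous, so their integrals pass to the limit.
  let P := (Ultrafilter.map Q (hyperfilter ℕ)).lim
  have hP : Tendsto Q (hyperfilter ℕ) (𝓝 P) := (Ultrafilter.map Q (hyperfilter ℕ)).le_nhds_lim
  refine ⟨P, (isPD_iff t P).2 ⟨P.2, fun k b => ?_⟩⟩
  have h1 := ProbabilityMeasure.tendsto_iff_forall_integral_tendsto.1 hP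
    (extendedHom (augMonomial k b))
  simp only [extendedHom_apply] at h1
  exact tendsto_nhds_unique h1
    ((tendsto_integral_rankedDirichlet ht b).mono_left Nat.hyperfilter_le_atTop)

theorem existsUnique_isPD {t : ℝ} (ht : 0 < t) : ∃! P : Measure simplex, IsPD t P := by
  obtain ⟨P, hP⟩ := exists_isPD ht
  refine ⟨P, hP, fun Q hQ => ?_⟩
  have := hP.1
  have := hQ.1
  refine measure_simplex_ext fun k b => ?_
  rw [((isPD_iff t P).1 hP).2, ((isPD_iff t Q).1 hQ).2]

/-! ### Moments determine finite measures on the cube -/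

/-- A polynomial as a bounded continuous function on the cube. -/
def polynomialOnCube (n : ℕ) : MvPolynomial (Fin n) ℝ →ₐ[ℝ]
    BoundedContinuousFunction (Set.univ.pi fun _ : Fin n => Set.Icc (0 : ℝ) 1) ℝ :=
  haveI : CompactSpace (Set.univ.pi fun _ : Fin n => Set.Icc (0 : ℝ) 1) :=
    isCompact_iff_compactSpace.1 (isCompact_univ_pi fun _ => isCompact_Icc)
  MvPolynomial.aeval fun i => BoundedContinuousFunction.mkOfCompact
    ⟨fun x => x.1 i, (continuous_apply i).comp continuous_subtype_val⟩

theorem polynomialOnCube_apply (n : ℕ) (p : MvPolynomial (Fin n) ℝ)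
    (x : Set.univ.pi fun _ : Fin n => Set.Icc (0 : ℝ) 1) :
    polynomialOnCube n p x = MvPolynomial.eval x.1 p := by
  induction p using MvPolynomial.induction_on with
  | C c => simp [polynomialOnCube]
  | add p q hp hq => simp [hp, hq]
  | mul_X p i hp =>
    rw [map_mul, BoundedContinuousFunction.mul_apply, hp, map_mul]
    simp [polynomialOnCube]

/-- Finite measures concentrated on the cube are determined by their moments. -/
theorem measure_ext_of_moments {n : ℕ} {μ ν : Measure (Fin n → ℝ)} [IsFiniteMeasure μ]
    [IsFiniteMeasure ν] (hμ : μ (Set.univ.pi fun _ => Set.Icc (0 : ℝ) 1)ᶜ = 0)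
    (hν : ν (Set.univ.pi fun _ => Set.Icc (0 : ℝ) 1)ᶜ = 0)
    (h : ∀ c : Fin n → ℕ, ∫⁻ x, ∏ i, ENNReal.ofReal (x i) ^ c i ∂μ =
      ∫⁻ x, ∏ i, ENNReal.ofReal (x i) ^ c i ∂ν) : μ = ν := by
  set K : Set (Fin n → ℝ) := Set.univ.pi fun _ => Set.Icc (0 : ℝ) 1 with hK
  have hKc : IsClosed K := isClosed_set_pi fun _ _ => isClosed_Icc
  have hKm : MeasurableSet K := hKc.measurableSet
  have hmono : ∀ (τ : Measure (Fin n → ℝ)), τ Kᶜ = 0 → ∀ c : Fin n →₀ ℕ,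
      ∫ x : K, MvPolynomial.eval x.1 (MvPolynomial.monomial c (1 : ℝ)) ∂(τ.comap Subtype.val) =
        (∫⁻ x, ∏ i, ENNReal.ofReal (x i) ^ c i ∂τ).toReal := by
    intro τ hτ c
    have hae : ∀ᵐ x ∂τ, x ∈ K := by rwa [ae_iff]
    rw [integral_subtype_comap hKm
      fun x => MvPolynomial.eval x (MvPolynomial.monomial c (1 : ℝ)),
      Measure.restrict_eq_self_of_ae_mem hae, integral_eq_lintegral_of_nonneg_ae]
    · congr 1
      refine lintegral_congr_ae ?_
      filter_upwards [hae] with x hx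
      rw [MvPolynomial.eval_monomial, one_mul, Finsupp.prod_fintype _ _ (by simp),
        ENNReal.ofReal_prod_of_nonneg fun i _ => pow_nonneg (hx i trivial).1 _]
      exact Finset.prod_congr rfl fun i _ => ENNReal.ofReal_pow (hx i trivial).1 _
    · filter_upwards [hae] with x hx
      rw [MvPolynomial.eval_monomial, one_mul, Finsupp.prod_fintype _ _ (by simp)]
      exact Finset.prod_nonneg fun i _ => pow_nonneg (hx i trivial).1 _
    · exact (MvPolynomial.continuous_eval _).aestronglyMeasurable
  have hfin : ∀ (τ : Measure (Fin n → ℝ)) [IsFiniteMeasure τ],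
      IsFiniteMeasure (τ.comap (Subtype.val : K → Fin n → ℝ)) := fun τ _ =>
    ⟨by
      rw [(MeasurableEmbedding.subtype_coe hKm).comap_apply]
      exact measure_lt_top _ _⟩
  have := hfin μ
  have := hfin ν
  have hpoly : ∀ p : MvPolynomial (Fin n) ℝ,
      ∫ x, polynomialOnCube n p x ∂(μ.comap (Subtype.val : K → Fin n → ℝ)) =
        ∫ x, polynomialOnCube n p x ∂(ν.comap (Subtype.val : K → Fin n → ℝ)) := by
    intro p
    induction p using MvPolynomial.induction_on' with
    | monomial u a =>
      have ha : MvPolynomial.monomial u a = a • MvPolynomial.monomial u (1 : ℝ) := by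
        rw [MvPolynomial.smul_monomial, smul_eq_mul, mul_one]
      simp only [ha, map_smul, BoundedContinuousFunction.coe_smul, smul_eq_mul,
        integral_const_mul, polynomialOnCube_apply]
      rw [hmono μ hμ, hmono ν hν, h]
    | add p q hp hq =>
      simp only [map_add, BoundedContinuousFunction.coe_add, Pi.add_apply]
      rw [integral_add (BoundedContinuousFunction.integrable _ _)
        (BoundedContinuousFunction.integrable _ _), hp, hq,
        integral_add (BoundedContinuousFunction.integrable _ _)
        (BoundedContinuousFunction.integrable _ _)]
  have heq : μ.comap (Subtype.val : K → Fin n → ℝ) = ν.comap Subtype.val := by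
    let A : StarSubalgebra ℝ (BoundedContinuousFunction K ℝ) :=
      { (polynomialOnCube n).range with
        star_mem' := by
          intro f hf
          have : star f = f := by ext; simp
          rwa [this] }
    have : PolishSpace K := hKc.polishSpace
    refine ext_of_forall_mem_subalgebra_integral_eq_of_polish (𝕜 := ℝ) (A := A) ?_ ?_
    · intro x y hxy
      obtain ⟨i, hi⟩ := Function.ne_iff.1 fun h => hxy (Subtype.ext h)
      refine ⟨_, ⟨_, ⟨polynomialOnCube n (MvPolynomial.X i), ⟨_, rfl⟩, rfl⟩, rfl⟩, ?_⟩
      change polynomialOnCube n (MvPolynomial.X i) x ≠ polynomialOnCube n (MvPolynomial.X i) y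
      rw [polynomialOnCube_apply, polynomialOnCube_apply]
      simpa using hi
    · rintro f ⟨p, rfl⟩
      exact hpoly p
  -- A measure that does not charge the complement of `K` is recovered from its trace on `K`.
  have hback : ∀ (τ : Measure (Fin n → ℝ)), τ Kᶜ = 0 →
      (τ.comap (Subtype.val : K → Fin n → ℝ)).map Subtype.val = τ := by
    intro τ hτ
    rw [(MeasurableEmbedding.subtype_coe hKm).map_comap, Subtype.range_coe]
    exact Measure.restrict_eq_self_of_ae_mem (by rwa [ae_iff])
  rw [← hback μ hμ, ← hback ν hν, heq]

/-! ### The correlation functions -/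

theorem correlationMeasure_apply (P : Measure simplex) {n : ℕ} {s : Set (Fin n → ℝ)}
    (hs : MeasurableSet s) : correlationMeasure P n s = ∫⁻ α, tupleMeasure n α s ∂P :=
  Measure.bind_apply hs (measurable_tupleMeasure n).aemeasurable

theorem measurableSet_Ioc_cube (n : ℕ) :
    MeasurableSet (Set.univ.pi fun _ : Fin n => Set.Ioc (0 : ℝ) 1) :=
  MeasurableSet.univ_pi fun _ => measurableSet_Ioc

theorem correlationMeasure_compl_cube (P : Measure simplex) (n : ℕ) :
    correlationMeasure P n (Set.univ.pi fun _ => Set.Ioc (0 : ℝ) 1)ᶜ = 0 := by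
  rw [correlationMeasure_apply P (measurableSet_Ioc_cube n).compl]
  refine (lintegral_congr fun α => ?_).trans lintegral_zero
  rw [tupleMeasure, Measure.sum_apply _ (measurableSet_Ioc_cube n).compl, ENNReal.tsum_eq_zero]
  intro f
  rw [Measure.dirac_apply' _ (measurableSet_Ioc_cube n).compl, Set.indicator_of_notMem]
  rw [Set.notMem_compl_iff]
  exact fun j _ => ⟨f.2 j, simplex_le_one α _⟩

theorem measurable_prod_ofReal_pow {n : ℕ} (c : Fin n → ℕ) :
    Measurable fun x : Fin n → ℝ => ∏ i, ENNReal.ofReal (x i) ^ c i :=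
  Finset.measurable_prod _ fun i _ => (measurable_pi_apply i).ennreal_ofReal.pow_const _

/-- Tuples with a zero coordinate contribute nothing to the monomial sum, so the restriction to
nonzero `αᵢ` in `tupleMeasure` costs nothing. The condition `b i ≠ 0` keeps the gap out. -/
theorem lintegral_correlationMeasure {t : ℝ} {P : Measure simplex} (hP : IsPD t P) {n : ℕ}
    (b : Fin n → ℕ) (hb : ∀ i, b i ≠ 0) :
    ∫⁻ x, ∏ i, ENNReal.ofReal (x i) ^ (b i + 1) ∂correlationMeasure P n =
      ENNReal.ofReal (ewensMoment t b) := by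
  have := hP.1
  rw [correlationMeasure, Measure.lintegral_bind (measurable_tupleMeasure n).aemeasurable
    (measurable_prod_ofReal_pow fun i => b i + 1).aemeasurable]
  have h : ∀ α : simplex, ∫⁻ x, ∏ i, ENNReal.ofReal (x i) ^ (b i + 1) ∂tupleMeasure n α =
      ENNReal.ofReal (extended (augMonomial n b) α) := by
    intro α
    rw [tupleMeasure, lintegral_sum_measure, ← (tsum_tupleMonomial_simplex α n b hb).1]
    simp only [fun f : {f : Fin n ↪ ℕ // ∀ j, 0 < α.1 (f j)} => lintegral_dirac'
      (fun j => α.1 (f.1 j)) (measurable_prod_ofReal_pow fun i => b i + 1)]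
    refine tsum_subtype_eq_of_support_subset
      (f := tupleMonomial b fun i => ENNReal.ofReal (α.1 i))
      (s := {f : Fin n ↪ ℕ | ∀ j, 0 < α.1 (f j)}) fun f hf j => ?_
    by_contra! hj
    refine hf (Finset.prod_eq_zero (Finset.mem_univ j) ?_)
    simp [ENNReal.ofReal_of_nonpos hj]
  simp only [h]
  rw [← ofReal_integral_eq_lintegral_ofReal (integrable_extended _ P)
    (.of_forall fun α => (tsum_tupleMonomial_simplex α n b hb).2), ((isPD_iff t P).1 hP).2]

/-- The correlation function of the Poisson–Dirichlet process. -/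
def pdDensity (t : ℝ) (n : ℕ) (x : Fin n → ℝ) : ℝ :=
  t ^ n * posPow (1 - ∑ i, x i) (t - 1) / ∏ i, x i

theorem measurable_pdDensity (t : ℝ) (n : ℕ) : Measurable (pdDensity t n) := by
  unfold pdDensity
  fun_prop

theorem pdDensity_nonneg {t : ℝ} (ht : 0 < t) {n : ℕ} {x : Fin n → ℝ}
    (hx : ∀ i, x i ∈ Set.Ioc 0 1) : 0 ≤ pdDensity t n x :=
  div_nonneg (mul_nonneg (pow_nonneg ht.le _) (posPow_nonneg _ _))
    (Finset.prod_nonneg fun i _ => (hx i).1.le)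

/-- The monomial cancels `1 / ∏ xᵢ` and leaves a Dirichlet integral with parameters `b i + 1` and
`t`. Extending it to all of space is free: off the cube some `xᵢ ≤ 0`, or all are positive and their
sum exceeds `1`. -/
theorem lintegral_pdDensity {t : ℝ} (ht : 0 < t) {n : ℕ} (b : Fin n → ℕ) :
    ∫⁻ x, ∏ i, ENNReal.ofReal (x i) ^ (b i + 1)
      ∂(volume.restrict (Set.univ.pi fun _ : Fin n => Set.Ioc (0 : ℝ) 1)).withDensity
        (fun x => ENNReal.ofReal (pdDensity t n x)) = ENNReal.ofReal (ewensMoment t b) := by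
  rw [lintegral_withDensity_eq_lintegral_mul _ (measurable_pdDensity t n).ennreal_ofReal
    (measurable_prod_ofReal_pow fun i => b i + 1), ← lintegral_indicator (measurableSet_Ioc_cube n)]
  have h : ∀ x : Fin n → ℝ, (Set.univ.pi fun _ : Fin n => Set.Ioc (0 : ℝ) 1).indicator
      ((fun x => ENNReal.ofReal (pdDensity t n x)) *
        fun x => ∏ i, ENNReal.ofReal (x i) ^ (b i + 1)) x =
      ENNReal.ofReal (t ^ n) * ENNReal.ofReal
        ((∏ i, posPow (x i) (((b i : ℝ) + 1) - 1)) * posPow (1 - ∑ i, x i) (t - 1)) := by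
    intro x
    by_cases hx : x ∈ Set.univ.pi fun _ : Fin n => Set.Ioc (0 : ℝ) 1
    · have hpos : ∀ i, 0 < x i := fun i => (hx i trivial).1
      have hprod : ∏ i, x i ≠ 0 := Finset.prod_ne_zero_iff.2 fun i _ => (hpos i).ne'
      rw [Set.indicator_of_mem hx, Pi.mul_apply]
      have h1 : ∏ i, ENNReal.ofReal (x i) ^ (b i + 1) = ENNReal.ofReal (∏ i, x i ^ (b i + 1)) := by
        rw [ENNReal.ofReal_prod_of_nonneg fun i _ => pow_nonneg (hpos i).le _]
        exact Finset.prod_congr rfl fun i _ => (ENNReal.ofReal_pow (hpos i).le _).symm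
      rw [h1, ← ENNReal.ofReal_mul (pdDensity_nonneg ht fun i => hx i trivial),
        ← ENNReal.ofReal_mul (pow_nonneg ht.le _), pdDensity]
      congr 1
      have h2 : ∏ i, posPow (x i) (((b i : ℝ) + 1) - 1) = ∏ i, x i ^ b i :=
        Finset.prod_congr rfl fun i _ => by
          rw [add_sub_cancel_right, posPow_of_pos (hpos i), Real.rpow_natCast]
      rw [h2]
      simp only [pow_succ, Finset.prod_mul_distrib]
      field_simp
    · rw [Set.indicator_of_notMem hx]
      symm
      simp only [Set.mem_univ_pi, not_forall] at hx
      by_cases hpos : ∀ i, 0 < x i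
      · obtain ⟨i, hi⟩ := hx
        have h1 : 1 < x i := by
          by_contra! h
          exact hi ⟨hpos i, h⟩
        have h2 := Finset.single_le_sum (fun j _ => (hpos j).le) (Finset.mem_univ i)
        rw [posPow_of_nonpos (y := 1 - ∑ i, x i) (by linarith), mul_zero, ENNReal.ofReal_zero,
          mul_zero]
      · push Not at hpos
        obtain ⟨i, hi⟩ := hpos
        rw [Finset.prod_eq_zero (Finset.mem_univ i) (posPow_of_nonpos hi _), zero_mul,
          ENNReal.ofReal_zero, mul_zero]
  simp only [h]
  rw [lintegral_const_mul' _ _ ENNReal.ofReal_ne_top,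
    lintegral_dirichlet _ (fun i => by positivity) ht, posPow_of_pos one_pos, Real.one_rpow,
    one_mul, ← ENNReal.ofReal_mul (pow_nonneg ht.le _), ewensMoment]
  congr 1
  have hsum : ∑ i, ((b i : ℝ) + 1) + t = t + (∑ i, (b i + 1) : ℕ) := by
    push_cast
    ring
  have hG := (Real.Gamma_pos_of_pos ht).ne'
  rw [hsum, Gamma_add_nat ht]
  simp only [Real.Gamma_nat_eq_factorial]
  field_simp

theorem correlationMeasure_eq {t : ℝ} (ht : 0 < t) {P : Measure simplex} (hP : IsPD t P) (n : ℕ) :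
    correlationMeasure P n =
      (volume.restrict (Set.univ.pi fun _ : Fin n => Set.Ioc (0 : ℝ) 1)).withDensity
        fun x => ENNReal.ofReal (pdDensity t n x) := by
  set μ := correlationMeasure P n with hμ
  set ν := (volume.restrict (Set.univ.pi fun _ : Fin n => Set.Ioc (0 : ℝ) 1)).withDensity
    fun x => ENNReal.ofReal (pdDensity t n x) with hν
  have hμ0 : μ (Set.univ.pi fun _ => Set.Ioc (0 : ℝ) 1)ᶜ = 0 := correlationMeasure_compl_cube P n
  have hν0 : ν (Set.univ.pi fun _ => Set.Ioc (0 : ℝ) 1)ᶜ = 0 :=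
    withDensity_absolutelyContinuous _ _
      (by rw [Measure.restrict_apply (measurableSet_Ioc_cube n).compl]; simp)
  -- The correlation measure may be infinite near `xᵢ = 0`. The square makes the mass finite and
  -- raises every exponent to at least `2`, where the moments are known.
  let w : (Fin n → ℝ) → ENNReal := fun x => ∏ i, ENNReal.ofReal (x i) ^ 2
  have hw : Measurable w := measurable_prod_ofReal_pow fun _ => 2
  have hmom : ∀ (τ : Measure (Fin n → ℝ)) (c : Fin n → ℕ),
      ∫⁻ x, ∏ i, ENNReal.ofReal (x i) ^ c i ∂τ.withDensity w =
        ∫⁻ x, ∏ i, ENNReal.ofReal (x i) ^ (c i + 1 + 1) ∂τ := by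
    intro τ c
    rw [lintegral_withDensity_eq_lintegral_mul _ hw (measurable_prod_ofReal_pow c)]
    refine lintegral_congr fun x => ?_
    rw [Pi.mul_apply, ← Finset.prod_mul_distrib]
    exact Finset.prod_congr rfl fun i _ => by ring
  have hμm : ∀ c : Fin n → ℕ, ∫⁻ x, ∏ i, ENNReal.ofReal (x i) ^ c i ∂μ.withDensity w =
      ENNReal.ofReal (ewensMoment t fun i => c i + 1) := fun c => by
    rw [hmom, hμ]
    exact lintegral_correlationMeasure hP (fun i => c i + 1) fun i => Nat.succ_ne_zero _
  have hνm : ∀ c : Fin n → ℕ, ∫⁻ x, ∏ i, ENNReal.ofReal (x i) ^ c i ∂ν.withDensity w =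
      ENNReal.ofReal (ewensMoment t fun i => c i + 1) := fun c => by
    rw [hmom, hν]
    exact lintegral_pdDensity ht fun i => c i + 1
  have hfin : ∀ τ : Measure (Fin n → ℝ), (∀ c : Fin n → ℕ,
      ∫⁻ x, ∏ i, ENNReal.ofReal (x i) ^ c i ∂τ.withDensity w =
      ENNReal.ofReal (ewensMoment t fun i => c i + 1)) → IsFiniteMeasure (τ.withDensity w) := by
    intro τ hτ
    have h := hτ fun _ => 0
    simp only [pow_zero, Finset.prod_const_one, lintegral_one] at h
    exact ⟨h.trans_lt ENNReal.ofReal_lt_top⟩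
  have hsub : (Set.univ.pi fun _ : Fin n => Set.Icc (0 : ℝ) 1)ᶜ ⊆
      (Set.univ.pi fun _ : Fin n => Set.Ioc (0 : ℝ) 1)ᶜ :=
    Set.compl_subset_compl.2 (Set.pi_mono fun _ _ => Set.Ioc_subset_Icc_self)
  have hkey : μ.withDensity w = ν.withDensity w := by
    have := hfin μ hμm
    have := hfin ν hνm
    exact measure_ext_of_moments
      (withDensity_absolutelyContinuous _ _ (measure_mono_null hsub hμ0))
      (withDensity_absolutelyContinuous _ _ (measure_mono_null hsub hν0))
      fun c => (hμm c).trans (hνm c).symm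
  -- On `(0, 1]ⁿ` the weight is positive and finite, so it can be divided out again.
  have hback : ∀ τ : Measure (Fin n → ℝ), τ (Set.univ.pi fun _ => Set.Ioc (0 : ℝ) 1)ᶜ = 0 →
      (τ.withDensity w).withDensity w⁻¹ = τ := by
    intro τ hτ
    refine withDensity_inv_same hw ?_ (.of_forall fun x =>
      ENNReal.prod_ne_top fun i _ => ENNReal.pow_ne_top ENNReal.ofReal_ne_top)
    have hae : ∀ᵐ x ∂τ, x ∈ Set.univ.pi fun _ => Set.Ioc (0 : ℝ) 1 := by rwa [ae_iff]
    filter_upwards [hae] with x hx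
    exact Finset.prod_ne_zero_iff.2 fun i _ =>
      pow_ne_zero _ (ENNReal.ofReal_pos.2 (hx i trivial).1).ne'
  rw [← hback μ hμ0, hkey, hback ν hν0]

/-! ### Simplicity of the process. -/

theorem volume_diagonal : volume {x : Fin 2 → ℝ | x 0 = x 1} = 0 := by
  let S : Submodule ℝ (Fin 2 → ℝ) :=
    LinearMap.ker (LinearMap.proj (R := ℝ) (φ := fun _ : Fin 2 => ℝ) 0 - LinearMap.proj 1)
  have hS : S ≠ ⊤ := by
    intro h
    have : (![1, 0] : Fin 2 → ℝ) ∈ S := by rw [h]; trivial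
    simp [S] at this
  have hset : {x : Fin 2 → ℝ | x 0 = x 1} = S := by
    ext x
    simp [S, sub_eq_zero]
  rw [hset]
  exact Measure.addHaar_submodule _ S hS

/-- A multiple point would be an atom of `tupleMeasure 2 α` on the diagonal, whose expected mass is
`0`. -/
theorem isSimpleProcess_of_isPD {t : ℝ} (ht : 0 < t) {P : Measure simplex} (hP : IsPD t P) :
    IsSimpleProcess P := by
  have hm : MeasurableSet {x : Fin 2 → ℝ | x 0 = x 1} :=
    measurableSet_eq_fun (measurable_pi_apply 0) (measurable_pi_apply 1)
  have h0 : correlationMeasure P 2 {x : Fin 2 → ℝ | x 0 = x 1} = 0 := by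
    rw [correlationMeasure_eq ht hP 2]
    exact withDensity_absolutelyContinuous _ _
      (Measure.restrict_le_self.absolutelyContinuous volume_diagonal)
  have hmeas : Measurable fun α : simplex => tupleMeasure 2 α {x : Fin 2 → ℝ | x 0 = x 1} :=
    (Measure.measurable_coe hm).comp (measurable_tupleMeasure 2)
  rw [correlationMeasure_apply P hm, lintegral_eq_zero_iff hmeas] at h0
  filter_upwards [h0] with α hα i j hij hi heq
  rw [Pi.zero_apply, tupleMeasure, Measure.sum_apply _ hm, ENNReal.tsum_eq_zero] at hα
  let f : Fin 2 ↪ ℕ := ⟨![i, j], by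
    intro a b hab
    fin_cases a <;> fin_cases b <;> simp_all⟩
  have hf : ∀ a, 0 < α.1 (f a) := by
    intro a
    fin_cases a
    · exact hi
    · exact heq ▸ hi
  have := hα ⟨f, hf⟩
  rw [Measure.dirac_apply' _ hm, Set.indicator_of_mem (by exact heq)] at this
  exact one_ne_zero this

end PoissonDirichlet

end

theorem corollary7p4 (t : ℝ) (ht : 0 < t) :
    (∃! P : Measure PoissonDirichlet.simplex, PoissonDirichlet.IsPD t P) ∧
      ∀ P : Measure PoissonDirichlet.simplex, PoissonDirichlet.IsPD t P →
        ∀ n : ℕ, 1 ≤ n →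
          PoissonDirichlet.IsCorrelationFunction P n fun x =>
            t ^ n * PoissonDirichlet.posPow (1 - ∑ i, x i) (t - 1) / ∏ i, x i := by
  refine ⟨PoissonDirichlet.existsUnique_isPD ht, fun P hP n _ => ?_⟩
  exact ⟨PoissonDirichlet.isSimpleProcess_of_isPD ht hP,
    PoissonDirichlet.measurable_pdDensity t n,
    fun x hx => PoissonDirichlet.pdDensity_nonneg ht hx,
    PoissonDirichlet.correlationMeasure_eq ht hP n⟩
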